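/- Conventions. For $\xi\in\mathbb{R}^3\setminus\{0\}$ write $\bar\xi=\xi/|\xi|$; $\hat f(\xi)=(2\pi)^{-3/2}\int f(x)e^{-i\langle x,\xi\rangle}dx$ is the unitary Fourier transform; $y_{lm}$ ($l\ge 0$, $-l\le m\le l$) are the standard complex spherical harmonics, orthonormal for surface measure on $S^2$, so that $\overline{y_{lm}}=(-1)^m y_{l,-m}$; $\tau_a(\omega)=e_a\times\omega$ ($a=1,2,3$) is the tangent field $\partial/\partial\phi_a$ of the longitude with respect to the $a$-th axis (Hedgehog frame). For a rotation $R\in SO(3)$ the Wigner-D matrix is $W(R)_{l,m}^{m'}=\int_{S^2}\overline{y_{lm}(\omega)}\,y_{lm'}(R^{-1}\omega)\,d\omega$. For fixed $(l,m)$, $G^{lm}$ is the $(L+1)^2\times(L+1)^2$ matrix of spherical harmonics product coefficients $G^{lm}_{(l_1m_1),(l_2m_2)}=\int_{S^2}y_{l_1m_1}\,y_{l_2m_2}\,\overline{y_{lm}}\,d\omega$, $l_1,l_2\le L$. Data. Let $\hat h:\mathbb{R}\to\mathbb{C}$ be measurable with $\hat h(r)=0$ for $r>\pi$. For every level $j\in\mathbb{Z}$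 let $L_j,M_j\ge 0$ be integers, let $\kappa^j_{lm}\in\mathbb{C}$ ($0\le l\le L_j$, $|m|\le l$) be angular localization coefficients with angular window $\gamma_j=\sum_{l\le L_j}\sum_{|m|\le l}\kappa^j_{lm}y_{lm}$, and let $R_{j,1},\dots,R_{j,M_j}\in SO(3)$. Let $w_{j,t}$ be the vector of rotated coefficients $\kappa^{j,t}_{lm}=\sum_{m'=-l}^{l}W(R_{j,t})_{l,m}^{m'}\kappa^j_{l,m'}$, and let $\tilde w_{j,t}$ be the vector with entries $(-1)^m\,\overline{\kappa^{j,t}_{l,-m}}$ (the coefficients of the complex conjugate of the rotated window; $\tilde w_{j,t}=w_{j,t}$ when the window is real-valued). Let $\psi_{a,j,t}$ be the inverse Fourier transform of $$\hat\psi_{a,j,t}(\xi)=-i\,\gamma_j(R_{j,t}^{-1}\bar\xi)\,\hat h(|\xi|)\,\tau_a(\bar\xi),$$ and define the frame functions $$\psi^a_{j,k,t}(x)=\frac{2^{3j/2}}{(2\pi)^{3/2}}\,\psi_{a,j,t}(2^jx-k),\qquad a=1,2,3,\ j\in\mathbb{Z},\ k\in\mathbb{Z}^3,\ 1\le t\le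 M_j .$$ Statement. Suppose that the Calderón condition $\sum_{j\in\mathbb{Z}}|\hat h(2^{-j}|\xi|)|^2=1$ holds for all $\xi\in\mathbb{R}^3\setminus\{0\}$, and that for every $j\in\mathbb{Z}$ and all $l\ge0$, $|m|\le l$, $$\sum_{t=1}^{M_j}\tilde w_{j,t}^{T}\,G^{lm}\,w_{j,t}=\sqrt{4\pi}\,\delta_{l,0}\,\delta_{m,0}.$$ Then all $\psi^a_{j,k,t}$ belong to the space $L_2^{\mathrm{div}}$ of (complex-valued) weakly divergence-free vector fields in $L_2(\mathbb{R}^3;\mathbb{C}^3)$, and they form a Parseval tight frame for it: for every $u\in L_2^{\mathrm{div}}$, in particular for every real-valued one, $$u=\sum_{a=1}^3\sum_{j\in\mathbb{Z}}\sum_{k\in\mathbb{Z}^3}\sum_{t=1}^{M_j}\langle u,\psi^a_{j,k,t}\rangle\,\psi^a_{j,k,t},\qquad \|u\|^2=\sum_{a,j,k,t}|\langle u,\psi^a_{j,k,t}\rangle|^2,$$ the first series converging unconditionally in $L_2$, where $\langle u,v\rangle=\int u\cdot\overline{v}\,dx$. -/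

import Mathlib

open MeasureTheory Polynomial
open scoped ContDiff Nat ComplexConjugate

namespace DivFreeWavelet

/-- Physical and frequency space. -/
abbrev E3 := EuclideanSpace ℝ (Fin 3)

/-- Values of vector fields (complex, so that real-valued fields are a special case). -/
abbrev C3 := EuclideanSpace ℂ (Fin 3)

/-- Legendre polynomial `P_l`, by the Rodrigues formula. -/
noncomputable def legendreP (l : ℕ) : ℝ[X] :=
  C (1 / (2 ^ l * (l ! : ℝ))) * derivative^[l] ((X ^ 2 - 1) ^ l)

/-- Associated Legendre function `P_l^m`, with the Condon-Shortley phase, and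
`P_l^{-n} = (-1)^n (l-n)!/(l+n)! P_l^n` for negative orders. -/
noncomputable def assocLegendre (l : ℕ) (m : ℤ) (x : ℝ) : ℝ :=
  (if 0 ≤ m then 1
    else (-1) ^ m.natAbs * (((l - m.natAbs)! : ℕ) : ℝ) / (((l + m.natAbs)! : ℕ) : ℝ)) *
  ((-1) ^ m.natAbs * Real.sqrt (1 - x ^ 2) ^ m.natAbs *
    (derivative^[m.natAbs] (legendreP l)).eval x)

/-- Normalization constant making the spherical harmonics orthonormal for surface measure. -/
noncomputable def shNorm (l : ℕ) (m : ℤ) : ℝ :=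
  Real.sqrt ((2 * (l : ℝ) + 1) / (4 * Real.pi) *
    (((((l : ℤ) - m).toNat)! : ℕ) : ℝ) / (((((l : ℤ) + m).toNat)! : ℕ) : ℝ))

/-- Spherical harmonic `y_{lm}` (for `|m| ≤ l`), evaluated at unit vectors `v`, where
`cos θ = v 2` and the azimuth is the argument of `v 0 + i v 1`. -/
noncomputable def sphHarm (l : ℕ) (m : ℤ) (v : E3) : ℂ :=
  ((shNorm l m * assocLegendre l m (v 2) : ℝ) : ℂ) *
    Complex.exp (Complex.I * (m : ℂ) * (Complex.arg ((v 0 : ℂ) + Complex.I * (v 1 : ℂ)) : ℂ))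

/-- Integral over the unit sphere with respect to surface measure (total mass `4π`). -/
noncomputable def sphereIntegral (f : E3 → ℂ) : ℂ :=
  ∫ v : Metric.sphere (0 : E3) 1, f v ∂((volume : Measure E3).toSphere)

/-- Index set of the `(L+1)^2` pairs `(l,m)` with `0 ≤ l ≤ L`, `-l ≤ m ≤ l`. -/
abbrev SHIndex (L : ℕ) := (l : Fin (L + 1)) × (Finset.Icc (-((l : ℕ) : ℤ)) ((l : ℕ) : ℤ))

/-- Spherical harmonics product (Clebsch-Gordan) coefficient: the projection of
`y_{l₁m₁} y_{l₂m₂}` onto `y_{lm}`. -/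
noncomputable def shProd (l₁ : ℕ) (m₁ : ℤ) (l₂ : ℕ) (m₂ : ℤ) (l : ℕ) (m : ℤ) : ℂ :=
  sphereIntegral fun v => sphHarm l₁ m₁ v * sphHarm l₂ m₂ v * conj (sphHarm l m v)

/-- The matrix `G^{lm}` of product coefficients for fixed `(l,m)`. -/
noncomputable def shProdMatrix (L l : ℕ) (m : ℤ) : Matrix (SHIndex L) (SHIndex L) ℂ :=
  Matrix.of fun p q => shProd p.1 p.2 q.1 q.2 l m

/-- Rotations of `ℝ³`. -/
abbrev Rot3 := Matrix.specialOrthogonalGroup (Fin 3) ℝ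

/-- The rotation `R` applied to a vector. -/
noncomputable def rotate (R : Rot3) (x : E3) : E3 :=
  WithLp.toLp 2 (Matrix.mulVec (R : Matrix (Fin 3) (Fin 3) ℝ) x.ofLp)

/-- Wigner-D matrix `W(R)_{l,m}^{m'}`: the matrix, in the basis `y_{lm}`, of the action
`g ↦ g ∘ R⁻¹` of rotations on functions on the sphere. -/
noncomputable def wignerD (R : Rot3) (l : ℕ) (m m' : ℤ) : ℂ :=
  sphereIntegral fun v => conj (sphHarm l m v) * sphHarm l m' (rotate R⁻¹ v)

/-- Rotated coefficients `∑_{m'} W(R)_{l,m}^{m'} κ_{l,m'}`. -/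
noncomputable def rotCoeff (R : Rot3) (κ : ℕ → ℤ → ℂ) (l : ℕ) (m : ℤ) : ℂ :=
  ∑ m' ∈ Finset.Icc (-(l : ℤ)) (l : ℤ), wignerD R l m m' * κ l m'

/-- Coefficients of the complex conjugate of the function with coefficients `c`; they agree
with `c` for a real-valued function. -/
noncomputable def conjCoeff (c : ℕ → ℤ → ℂ) (l : ℕ) (m : ℤ) : ℂ :=
  (-1) ^ m.natAbs * conj (c l (-m))

/-- The coefficient vector with entries `c_{lm}`, `l ≤ L`. -/
def coeffVec (L : ℕ) (c : ℕ → ℤ → ℂ) : SHIndex L → ℂ := fun p => c p.1 p.2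

/-- Angular window `γ = ∑_{l ≤ L} ∑_m κ_{lm} y_{lm}`. -/
noncomputable def angularWindow (L : ℕ) (κ : ℕ → ℤ → ℂ) (v : E3) : ℂ :=
  ∑ l ∈ Finset.range (L + 1), ∑ m ∈ Finset.Icc (-(l : ℤ)) (l : ℤ), κ l m * sphHarm l m v

/-- Hedgehog frame vector `τ_a(v) = ∂/∂φ_a = e_a × v`. -/
noncomputable def hedgehog (a : Fin 3) (v : E3) : C3 :=
  WithLp.toLp 2 fun i => ((crossProduct (Pi.single a (1 : ℝ)) v.ofLp i : ℝ) : ℂ)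

/-- The mother wavelet for the axis `a` in frequency, with angular window rotated by `R`:
`ψ̂(ξ) = -i γ(R⁻¹ ξ̄) ĥ(|ξ|) τ_a(ξ̄)`, where `ξ̄ = ξ/|ξ|`. -/
noncomputable def waveletHat (h : ℝ → ℂ) (L : ℕ) (κ : ℕ → ℤ → ℂ) (R : Rot3) (a : Fin 3)
    (ξ : E3) : C3 :=
  (-Complex.I * angularWindow L κ (rotate R⁻¹ (‖ξ‖⁻¹ • ξ)) * h ‖ξ‖) •
    hedgehog a (‖ξ‖⁻¹ • ξ)

/-- Its (unitary) inverse Fourier transform. -/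
noncomputable def wavelet (h : ℝ → ℂ) (L : ℕ) (κ : ℕ → ℤ → ℂ) (R : Rot3) (a : Fin 3)
    (x : E3) : C3 :=
  (((2 * Real.pi) ^ (-(3 / 2) : ℝ) : ℝ) : ℂ) •
    ∫ ξ : E3, Complex.exp (Complex.I * ((inner ℝ ξ x : ℝ) : ℂ)) • waveletHat h L κ R a ξ

/-- Indices `(a, j, k, t)`: axis, scale, lattice translate, orientation. -/
abbrev FrameIndex (M : ℤ → ℕ) := Fin 3 × ((j : ℤ) × ((Fin 3 → ℤ) × Fin (M j)))

/-- The frame functions `2^{3j/2} (2π)^{-3/2} ψ_{a,j,t}(2^j x - k)`. -/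
noncomputable def frameFun (h : ℝ → ℂ) (L : ℤ → ℕ) (κ : ℤ → ℕ → ℤ → ℂ) (M : ℤ → ℕ)
    (R : (j : ℤ) → Fin (M j) → Rot3) (s : FrameIndex M) (x : E3) : C3 :=
  (((2 : ℝ) ^ (3 * (s.2.1 : ℝ) / 2) / (2 * Real.pi) ^ (3 / 2 : ℝ) : ℝ) : ℂ) •
    wavelet h (L s.2.1) (κ s.2.1) (R s.2.1 s.2.2.2) s.1
      ((2 : ℝ) ^ s.2.1 • x - WithLp.toLp 2 (fun i => (s.2.2.1 i : ℝ)))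

/-- Weak divergence freedom: `∫ u · ∇f = 0` for every test function `f`. -/
def IsDivFree (u : E3 → C3) : Prop :=
  ∀ f : E3 → ℝ, ContDiff ℝ ∞ f → HasCompactSupport f →
    ∫ x, ∑ i, ((fderiv ℝ f x (EuclideanSpace.single i 1) : ℝ) : ℂ) * u x i = 0

end DivFreeWavelet

open DivFreeWavelet

/-! Everything is computed on the Fourier transform `U = 𝓕 u`. By Plancherel, the coefficient of `u`
against the frame function `(a, j, k, t)` is, after a dilation by `2 ^ j`, the `k`-th Fourier
coefficient of a rescaled scalar function `pairing`, the pointwise inner product of the mother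
wavelet in frequency with `U`. As `h` vanishes beyond `π`, the dilated function is supported in the
ball of radius `1/2`, inside a single period cell. Parseval for Fourier series therefore turns the
sum over `k` into an `L²` norm, without aliasing (`hasSum_translates`).

The remaining sums are pointwise in frequency and factor (`tsum_pairing`). The sum over `t` of the
squared windows is `1` on the sphere, the sum over `j` is the Calderón condition, and the sum over
`a` of `|⟨e_a × ν, v⟩|²` is `|v|² - |ν · v|²`. The total is thus the integral of `|U|² - |ν · U|²`
with `ν = η / |η|`. It is at most `‖u‖²` for every `u`, and equals `‖u‖²` when `u` is
divergence-free, because then `η · U(η) = 0` almost everywhere. Bessel on all of `L²` together with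
Parseval at `u` gives unconditional reconstruction (`hasSum_inner_smul`).

The angular condition yields the partition of unity as follows (`sum_norm_sq_angularWindow`). The
form defined by `G^{lm}` computes the `(l, m)` coefficient of a product of two windows
(`dotProduct_shProdMatrix`), so the hypothesis says that the sum of the squared moduli of the
rotated windows has the coefficients of the constant `1 = √(4π) y_00`. This sum is a polynomial on
the sphere, hence determined by its coefficients. The argument uses that the explicit `y_lm` are
orthonormal (`sphInner_harm`), that they span the polynomials on the sphere
(`affineFuns_pow_le_harmSpan`), and that a rotation acts on each degree through the Wigner matrix
(`pullback_harm`). -/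

namespace DivFreeWavelet

/-! ### Legendre polynomials and associated Legendre orthogonality -/

/-- Integration of a polynomial over `[-1, 1]`. -/
noncomputable def intervalInt : ℝ[X] →ₗ[ℝ] ℝ where
  toFun p := ∫ x in (-1 : ℝ)..1, p.eval x
  map_add' p q := by
    simp only [eval_add]
    exact intervalIntegral.integral_add (p.continuous.intervalIntegrable _ _)
      (q.continuous.intervalIntegrable _ _)
  map_smul' c p := by simp

lemma intervalInt_apply (p : ℝ[X]) : intervalInt p = ∫ x in (-1 : ℝ)..1, p.eval x := rfl

lemma intervalInt_C_mul (c : ℝ) (p : ℝ[X]) : intervalInt (C c * p) = c * intervalInt p := by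
  rw [← smul_eq_C_mul, map_smul, smul_eq_mul]

lemma intervalInt_derivative (p : ℝ[X]) :
    intervalInt (derivative p) = p.eval 1 - p.eval (-1) :=
  intervalIntegral.integral_eq_sub_of_hasDerivAt (fun x _ => p.hasDerivAt x)
    ((derivative p).continuous.intervalIntegrable _ _)

lemma intervalInt_derivative_mul {p : ℝ[X]} (h1 : p.eval 1 = 0) (h2 : p.eval (-1) = 0) (q : ℝ[X]) :
    intervalInt (derivative p * q) = -intervalInt (p * derivative q) := by
  have := intervalInt_derivative (p * q)
  rw [derivative_mul, map_add] at this
  simp only [eval_mul, h1, h2, zero_mul, sub_zero] at this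
  linarith

lemma intervalInt_X_pow (n : ℕ) : intervalInt (X ^ n) = (1 - (-1) ^ (n + 1)) / (n + 1) := by
  simp [intervalInt_apply]

/-- Iterated derivatives of `(X ^ 2 - 1) ^ l`. -/
noncomputable def rodrigues (l k : ℕ) : ℝ[X] := derivative^[k] ((X ^ 2 - 1) ^ l)

lemma rodrigues_succ (l k : ℕ) : rodrigues l (k + 1) = derivative (rodrigues l k) :=
  Function.iterate_succ_apply' _ _ _

lemma rodrigues_eval_eq_zero {l k : ℕ} (hk : k < l) {x : ℝ} (hx : x ^ 2 = 1) :
    (rodrigues l k).eval x = 0 := by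
  obtain ⟨q, hq⟩ := pow_sub_dvd_iterate_derivative_pow ((X : ℝ[X]) ^ 2 - 1) l k
  rw [rodrigues, hq]
  simp [hx, zero_pow (Nat.sub_ne_zero_of_lt hk)]

/-- The function `u = (x² - 1)^l` satisfies `(x² - 1) u' = 2 l x u`. Differentiating once gives the
case `k = 0`, and each further derivative raises `k` by one. -/
lemma rodrigues_ode (l k : ℕ) :
    (X ^ 2 - 1) * rodrigues l (k + 2) + C (2 * (k + 1 - l : ℝ)) * X * rodrigues l (k + 1) +
      C ((k + 1) * (k - 2 * l) : ℝ) * rodrigues l k = 0 := by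
  induction k with
  | zero =>
    have h1 : (X ^ 2 - 1) * rodrigues l 1 = C (2 * l : ℝ) * X * rodrigues l 0 := by
      simp only [rodrigues, Function.iterate_one, Function.iterate_zero, id]
      rcases l with _ | l
      · simp
      · simp [derivative_pow]
        ring
    have h2 := congrArg derivative h1
    simp only [derivative_mul, derivative_sub, derivative_X_pow, derivative_one, derivative_C,
      derivative_X, ← rodrigues_succ] at h2
    simp only [map_mul, map_sub, map_add, map_natCast, map_ofNat, map_one, Nat.cast_zero,
      C_0] at h2 ⊢
    push_cast at h2
    linear_combination h2
  | succ k ih =>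
    have h2 := congrArg derivative ih
    simp only [derivative_mul, derivative_sub, derivative_add, derivative_X_pow, derivative_one,
      derivative_C, derivative_X, derivative_zero, ← rodrigues_succ] at h2
    simp only [map_mul, map_sub, map_add, map_natCast, map_ofNat, map_one, Nat.cast_add,
      Nat.cast_one] at h2 ⊢
    push_cast at h2
    linear_combination h2

/-- Integration by parts `k` times; the boundary terms vanish because derivatives of `(x² - 1)^l` of
order below `l` are zero at `±1`. -/
lemma intervalInt_rodrigues_mul {l k : ℕ} (hk : k ≤ l) (q : ℝ[X]) :
    intervalInt (rodrigues l l * q) =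
      (-1) ^ k * intervalInt (rodrigues l (l - k) * derivative^[k] q) := by
  induction k with
  | zero => simp
  | succ k ih =>
    rw [ih (by omega), show l - k = l - (k + 1) + 1 by omega, rodrigues_succ,
      intervalInt_derivative_mul (rodrigues_eval_eq_zero (by omega) (by norm_num))
        (rodrigues_eval_eq_zero (by omega) (by norm_num)), ← Function.iterate_succ_apply' derivative]
    ring

/-- Integrate by parts against `x` and write `x² = (x² - 1) + 1`. -/
lemma intervalInt_sq_sub_one_pow_succ (l : ℕ) :
    (2 * l + 3) * intervalInt ((X ^ 2 - 1) ^ (l + 1)) =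
      -(2 * (l + 1)) * intervalInt ((X ^ 2 - 1) ^ l) := by
  have h := intervalInt_derivative_mul (p := (X ^ 2 - 1) ^ (l + 1)) (by simp) (by simp) X
  have e : derivative (((X : ℝ[X]) ^ 2 - 1) ^ (l + 1)) * X =
      C (2 * (l + 1) : ℝ) * ((X ^ 2 - 1) ^ (l + 1) + (X ^ 2 - 1) ^ l) := by
    simp [derivative_pow]
    ring
  rw [e, intervalInt_C_mul, map_add, derivative_X, mul_one] at h
  linarith

lemma intervalInt_sq_sub_one_pow (l : ℕ) :
    intervalInt ((X ^ 2 - 1) ^ l) =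
      (-1) ^ l * (2 ^ l * l ! : ℝ) ^ 2 * 2 / ((2 * l + 1) * (2 * l)!) := by
  induction l with
  | zero => simp [intervalInt_apply]; norm_num
  | succ l ih =>
    have h := intervalInt_sq_sub_one_pow_succ l
    rw [ih] at h
    have h3 : (2 * (l : ℝ) + 3) ≠ 0 := by positivity
    have h4 : intervalInt ((X ^ 2 - 1) ^ (l + 1)) = (-(2 * (l + 1)) *
      ((-1) ^ l * (2 ^ l * l ! : ℝ) ^ 2 * 2 / ((2 * l + 1) * (2 * l)!))) / (2 * l + 3) := by
      rw [eq_div_iff h3]; linarith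
    rw [h4, show 2 * (l + 1) = 2 * l + 1 + 1 by ring, Nat.factorial_succ, Nat.factorial_succ,
      Nat.factorial_succ]
    push_cast
    have : ((2 * l)! : ℝ) ≠ 0 := by positivity
    have : (2 * (l : ℝ) + 1) ≠ 0 := by positivity
    have : (2 * ((l : ℝ) + 1) + 1) ≠ 0 := by positivity
    field_simp
    ring

lemma natDegree_sq_sub_one_pow (l : ℕ) : (((X : ℝ[X]) ^ 2 - 1) ^ l).natDegree = 2 * l := by
  rw [natDegree_pow, show (1 : ℝ[X]) = C 1 by simp, natDegree_X_pow_sub_C]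
  ring

lemma monic_sq_sub_one_pow (l : ℕ) : (((X : ℝ[X]) ^ 2 - 1) ^ l).Monic := by
  refine Monic.pow ?_ l
  rw [show (1 : ℝ[X]) = C 1 by simp]
  exact monic_X_pow_sub_C 1 (by norm_num)

lemma rodrigues_two_mul (l : ℕ) : rodrigues l (2 * l) = C ((2 * l)! : ℝ) := by
  have h := iterate_derivative_eq_factorial_smul_sum ((X ^ 2 - 1 : ℝ[X]) ^ l) (2 * l)
  rw [rodrigues]
  have hd : (derivative^[2 * l] (((X : ℝ[X]) ^ 2 - 1) ^ l)).natDegree = 0 := by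
    have := natDegree_iterate_derivative (((X : ℝ[X]) ^ 2 - 1) ^ l) (2 * l)
    rw [natDegree_sq_sub_one_pow] at this
    omega
  rw [eq_C_of_natDegree_eq_zero hd, coeff_iterate_derivative, zero_add, Nat.descFactorial_self]
  have := (monic_sq_sub_one_pow l).coeff_natDegree
  rw [natDegree_sq_sub_one_pow] at this
  simp [this]

lemma natDegree_rodrigues_le (l k : ℕ) : (rodrigues l k).natDegree ≤ 2 * l - k := by
  have := natDegree_iterate_derivative (((X : ℝ[X]) ^ 2 - 1) ^ l) k
  rwa [natDegree_sq_sub_one_pow] at this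

lemma legendreP_eq (l : ℕ) : legendreP l = C (1 / (2 ^ l * (l ! : ℝ))) * rodrigues l l := rfl

lemma iterate_derivative_legendreP (l m : ℕ) :
    derivative^[m] (legendreP l) = C (1 / (2 ^ l * (l ! : ℝ))) * rodrigues l (l + m) := by
  rw [legendreP_eq, iterate_derivative_C_mul, rodrigues, rodrigues, ← Function.iterate_add_apply,
    add_comm]

lemma intervalInt_legendreP_mul_of_lt (l : ℕ) {q : ℝ[X]} (hq : q.natDegree < l) :
    intervalInt (legendreP l * q) = 0 := by
  rw [legendreP_eq, mul_assoc, intervalInt_C_mul, intervalInt_rodrigues_mul le_rfl,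
    iterate_derivative_eq_zero hq]
  simp

lemma intervalInt_legendreP_mul_self (l : ℕ) :
    intervalInt (legendreP l * legendreP l) = 2 / (2 * l + 1) := by
  have h : legendreP l * legendreP l =
      C (1 / (2 ^ l * (l ! : ℝ)) * (1 / (2 ^ l * (l ! : ℝ)))) * (rodrigues l l * rodrigues l l) := by
    rw [legendreP_eq, C_mul]; ring
  rw [h, intervalInt_C_mul, intervalInt_rodrigues_mul le_rfl, Nat.sub_self]
  have h2 : derivative^[l] (rodrigues l l) = C ((2 * l)! : ℝ) := by
    rw [rodrigues, ← Function.iterate_add_apply, ← two_mul]; exact rodrigues_two_mul l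
  rw [h2, mul_comm (rodrigues l 0), intervalInt_C_mul, rodrigues, Function.iterate_zero, id,
    intervalInt_sq_sub_one_pow]
  have : ((2 * l)! : ℝ) ≠ 0 := by positivity
  have : (2 * (l : ℝ) + 1) ≠ 0 := by positivity
  have hs : ((-1 : ℝ) ^ l) ^ 2 = 1 := by rw [← pow_mul, mul_comm, pow_mul]; simp
  field_simp
  linear_combination hs

lemma natDegree_legendreP_le (l : ℕ) : (legendreP l).natDegree ≤ l := by
  refine (natDegree_C_mul_le _ _).trans ((natDegree_rodrigues_le l l).trans ?_)
  omega

lemma intervalInt_legendreP_mul (l l' : ℕ) :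
    intervalInt (legendreP l * legendreP l') = if l = l' then 2 / (2 * (l : ℝ) + 1) else 0 := by
  split_ifs with h
  · rw [← h, intervalInt_legendreP_mul_self]
  · rcases lt_or_gt_of_ne h with h | h
    · rw [mul_comm]
      exact intervalInt_legendreP_mul_of_lt l' ((natDegree_legendreP_le l).trans_lt h)
    · exact intervalInt_legendreP_mul_of_lt l ((natDegree_legendreP_le l').trans_lt h)

/-- The Sturm–Liouville form of the Legendre equation differentiated `m` times. It is what lets
integration by parts lower the order `m`. -/
lemma derivative_weight_mul_iterate_derivative_legendreP (l m : ℕ) :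
    derivative ((1 - X ^ 2) ^ (m + 1) * derivative^[m + 1] (legendreP l)) =
      C (-(l - m) * (l + m + 1) : ℝ) * ((1 - X ^ 2) ^ m * derivative^[m] (legendreP l)) := by
  have h := rodrigues_ode l (l + m)
  have h1 : derivative ((1 - (X : ℝ[X]) ^ 2) ^ (m + 1)) =
      C (-2 * (m + 1) : ℝ) * X * (1 - X ^ 2) ^ m := by
    simp [derivative_pow]
    ring
  have h2 : C ((l : ℝ) + m + 1 - l) = C ((m : ℝ) + 1) := by congr 1; ring
  simp only [iterate_derivative_legendreP, derivative_mul, h1, derivative_C, ← add_assoc,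
    ← rodrigues_succ, Nat.cast_add] at h ⊢
  simp only [map_mul, map_sub, map_add, map_natCast, map_ofNat, map_one, map_neg] at h ⊢
  linear_combination (-(1 - X ^ 2) ^ m * C (1 / (2 ^ l * (l ! : ℝ)))) * h

lemma intervalInt_weight_succ (l m : ℕ) (q : ℝ[X]) :
    intervalInt ((1 - X ^ 2) ^ (m + 1) * derivative^[m + 1] (legendreP l) * derivative q) =
      ((l - m) * (l + m + 1)) *
        intervalInt ((1 - X ^ 2) ^ m * derivative^[m] (legendreP l) * q) := by
  have := intervalInt_derivative_mul (p := (1 - X ^ 2) ^ (m + 1) * derivative^[m + 1] (legendreP l))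
    (by simp) (by simp) q
  rw [derivative_weight_mul_iterate_derivative_legendreP, mul_assoc, intervalInt_C_mul] at this
  linarith

/-- Orthogonality of the associated Legendre functions of equal order. -/
lemma intervalInt_assocLegendre (l l' m : ℕ) (hm : m ≤ l) :
    intervalInt ((1 - X ^ 2) ^ m * derivative^[m] (legendreP l) * derivative^[m] (legendreP l')) =
      if l = l' then 2 / (2 * (l : ℝ) + 1) * ((l + m)! / (l - m)!) else 0 := by
  induction m with
  | zero =>
    have : ((l ! : ℕ) : ℝ) ≠ 0 := by positivity
    simp [intervalInt_legendreP_mul, div_self this]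
  | succ m ih =>
    rw [Function.iterate_succ_apply' derivative m (legendreP l'), intervalInt_weight_succ,
      ih (by omega)]
    split_ifs with h
    · have e1 : (l - m)! = (l - m) * (l - (m + 1))! := by
        rw [show l - m = l - (m + 1) + 1 by omega, Nat.factorial_succ]
      have e2 : (((l - m : ℕ) : ℝ)) = l - m := by rw [Nat.cast_sub (by omega)]
      rw [← add_assoc, Nat.factorial_succ, e1]
      push_cast
      rw [e2]
      have : ((l - (m + 1))! : ℝ) ≠ 0 := by positivity
      have : (l : ℝ) - m ≠ 0 := by
        rw [sub_ne_zero]; exact_mod_cast (by omega : l ≠ m)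
      have : (2 * (l : ℝ) + 1) ≠ 0 := by positivity
      field_simp
    · simp

lemma natDegree_iterate_derivative_legendreP_le (l m : ℕ) :
    (derivative^[m] (legendreP l)).natDegree ≤ l - m :=
  (natDegree_iterate_derivative _ _).trans (Nat.sub_le_sub_right (natDegree_legendreP_le l) m)

/-- This leading coefficient allows polynomials in `z` to be reduced degree by degree when the
harmonics are shown to span. -/
lemma coeff_iterate_derivative_legendreP_ne_zero (m c : ℕ) :
    (derivative^[m] (legendreP (m + c))).coeff c ≠ 0 := by
  have := (monic_sq_sub_one_pow (m + c)).coeff_natDegree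
  rw [natDegree_sq_sub_one_pow] at this
  rw [iterate_derivative_legendreP, coeff_C_mul, rodrigues, coeff_iterate_derivative,
    show c + (m + c + m) = 2 * (m + c) by ring, this]
  have h : (2 * (m + c)).descFactorial (m + c + m) ≠ 0 := by
    rw [Ne, Nat.descFactorial_eq_zero_iff_lt]; omega
  simp only [nsmul_eq_mul, mul_one]
  have h' : (((2 * (m + c)).descFactorial (m + c + m) : ℕ) : ℝ) ≠ 0 := by exact_mod_cast h
  positivity

/-! ### Surface measure: polar coordinates, zonal integrals, rotation invariance -/

/-- The unit sphere of `E3`. -/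
abbrev S2 := Metric.sphere (0 : E3) 1

/-- Surface measure on the unit sphere. -/
noncomputable abbrev surface : Measure S2 := (volume : Measure E3).toSphere

/-- Polar coordinates, with no integrability assumption. With a Gaussian radial factor, surface
integrals can be read off from integrals over space. -/
lemma integral_mul_fun_norm {𝕜 : Type*} [RCLike 𝕜] (f : E3 → 𝕜) (g : ℝ → 𝕜) :
    ∫ x : E3, f (‖x‖⁻¹ • x) * g ‖x‖ =
      (∫ v : S2, f v ∂surface) * ∫ r in Set.Ioi (0 : ℝ), ((r ^ 2 : ℝ) : 𝕜) * g r := by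
  have h1 : ∫ x : E3, f (‖x‖⁻¹ • x) * g ‖x‖ =
      ∫ x : ({(0 : E3)}ᶜ : Set E3), f (‖(x : E3)‖⁻¹ • (x : E3)) * g ‖(x : E3)‖
        ∂((volume : Measure E3).comap (↑)) := by
    rw [integral_subtype_comap (measurableSet_singleton _).compl
      fun x : E3 => f (‖x‖⁻¹ • x) * g ‖x‖, restrict_compl_singleton]
  have h2 := (volume : Measure E3).measurePreserving_homeomorphUnitSphereProd.integral_comp
    (Homeomorph.measurableEmbedding _)
    (fun p : S2 × Set.Ioi (0 : ℝ) => f p.1 * g p.2)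
  simp only [homeomorphUnitSphereProd_apply_fst_coe,
    homeomorphUnitSphereProd_apply_snd_coe] at h2
  rw [h1, h2, integral_prod_mul (fun v : S2 => f v) (fun r : Set.Ioi (0 : ℝ) => g r)]
  congr 1
  simp only [Measure.volumeIoiPow, ENNReal.ofReal, finrank_euclideanSpace, Fintype.card_fin,
    Nat.add_one_sub_one]
  rw [integral_withDensity_eq_integral_smul
      (by exact (measurable_subtype_coe.pow_const _).real_toNNReal),
    integral_subtype_comap measurableSet_Ioi fun a : ℝ => Real.toNNReal (a ^ 2) • g a]
  refine setIntegral_congr_fun measurableSet_Ioi fun x hx => ?_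
  simp only [NNReal.smul_def, Real.coe_toNNReal _ (pow_nonneg (le_of_lt hx) _)]
  rw [RCLike.real_smul_eq_coe_mul]

/-- The integral of `r ^ n * exp (-r ^ 2)` over the half line. -/
noncomputable def gaussMoment (n : ℕ) : ℝ := ∫ r in Set.Ioi (0 : ℝ), r ^ n * Real.exp (-r ^ 2)

lemma gaussMoment_eq (n : ℕ) : gaussMoment n = 1 / 2 * Real.Gamma ((n + 1) / 2) := by
  rw [← integral_rpow_mul_exp_neg_rpow (p := 2) (q := n) (by norm_num)
    (by linarith [Nat.cast_nonneg (α := ℝ) n])]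
  refine setIntegral_congr_fun measurableSet_Ioi fun x hx => ?_
  simp only [Real.rpow_natCast]
  norm_num

lemma gaussMoment_pos (n : ℕ) : 0 < gaussMoment n := by
  rw [gaussMoment_eq]
  have := Real.Gamma_pos_of_pos (show (0 : ℝ) < (n + 1) / 2 by positivity)
  positivity

lemma gaussMoment_add_two (n : ℕ) : gaussMoment (n + 2) = (n + 1) / 2 * gaussMoment n := by
  rw [gaussMoment_eq, gaussMoment_eq, show ((n + 2 : ℕ) + 1 : ℝ) / 2 = (n + 1) / 2 + 1 by
    push_cast; ring, Real.Gamma_add_one (by positivity)]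
  ring

lemma integral_exp_neg_sq : ∫ x : ℝ, Real.exp (-x ^ 2) = Real.sqrt Real.pi := by
  have := integral_gaussian 1
  simpa using this

lemma integral_pow_mul_exp_neg_sq (n : ℕ) :
    ∫ x : ℝ, x ^ n * Real.exp (-x ^ 2) = (1 + (-1) ^ n) * gaussMoment n := by
  rcases Nat.even_or_odd n with h | h
  · have := integral_comp_abs (f := fun x : ℝ => x ^ n * Real.exp (-x ^ 2))
    simp only [h.pow_abs, sq_abs] at this
    rw [this, h.neg_one_pow, gaussMoment]
    ring
  · have := integral_neg_eq_self (fun x : ℝ => x ^ n * Real.exp (-x ^ 2)) volume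
    simp only [h.neg_pow, even_two.neg_pow, neg_mul] at this
    rw [integral_neg] at this
    rw [h.neg_one_pow]
    linarith

lemma integral_gauss_space (n : ℕ) :
    ∫ x : E3, (x 2) ^ n * Real.exp (-‖x‖ ^ 2) = (1 + (-1) ^ n) * gaussMoment n * Real.pi := by
  have h := (EuclideanSpace.volume_preserving_symm_measurableEquiv_toLp (Fin 3)).symm.integral_comp
    (MeasurableEquiv.measurableEmbedding _) (fun x : E3 => (x 2) ^ n * Real.exp (-‖x‖ ^ 2))
  rw [← h]
  have h2 := integral_fintype_prod_volume_eq_prod (𝕜 := ℝ)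
    (fun (i : Fin 3) (x : ℝ) => (if i = 2 then x ^ n else 1) * Real.exp (-x ^ 2))
  rw [Fin.prod_univ_three] at h2
  simp only [Fin.prod_univ_three] at h2
  simp only [show (0 : Fin 3) ≠ 2 by decide, show (1 : Fin 3) ≠ 2 by decide, if_true, if_false,
    one_mul, integral_exp_neg_sq, integral_pow_mul_exp_neg_sq] at h2
  rw [Real.mul_self_sqrt Real.pi_pos.le] at h2
  rw [mul_comm _ Real.pi, ← h2]
  congr 1
  ext y
  simp only [MeasurableEquiv.symm_symm, MeasurableEquiv.coe_toLp, EuclideanSpace.norm_sq_eq,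
    Fin.sum_univ_three, Real.norm_eq_abs, sq_abs, neg_add, Real.exp_add]
  ring

/-- The Gaussian integral of `z ^ n` is evaluated twice, by Fubini in Cartesian coordinates and in
polar coordinates. The common factor `gaussMoment n` cancels through its recursion. -/
lemma integral_surface_pow (n : ℕ) :
    ∫ v : S2, ((v : E3) 2) ^ n ∂surface = 2 * Real.pi * intervalInt (X ^ n) := by
  have h := integral_mul_fun_norm (𝕜 := ℝ) (fun v => (v 2) ^ n)
    (fun r => r ^ n * Real.exp (-r ^ 2))
  have h1 : ∫ x : E3, ((‖x‖⁻¹ • x) 2) ^ n * (‖x‖ ^ n * Real.exp (-‖x‖ ^ 2)) =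
      ∫ x : E3, (x 2) ^ n * Real.exp (-‖x‖ ^ 2) := by
    refine integral_congr_ae ?_
    filter_upwards [compl_mem_ae_iff.2 (measure_singleton (0 : E3))] with x hx
    have hx : ‖x‖ ≠ 0 := norm_ne_zero_iff.2 hx
    simp only [PiLp.smul_apply, smul_eq_mul, mul_pow, inv_pow]
    field_simp
  have h2 : ∫ r in Set.Ioi (0 : ℝ), ((r ^ 2 : ℝ) : ℝ) * (r ^ n * Real.exp (-r ^ 2)) =
      gaussMoment (n + 2) := by
    rw [gaussMoment]
    congr 1
    ext r
    ring
  rw [h1, integral_gauss_space] at h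
  simp only [RCLike.ofReal_real_eq_id, id] at h
  rw [h2, gaussMoment_add_two] at h
  rw [intervalInt_X_pow]
  have hg := (gaussMoment_pos n).ne'
  have hn : ((n : ℝ) + 1) ≠ 0 := by positivity
  have h3 : (1 + (-1) ^ n) * Real.pi = (∫ v : S2, ((v : E3) 2) ^ n ∂surface) * ((n + 1) / 2) :=
    mul_right_cancel₀ hg (by linarith)
  rw [pow_succ]
  field_simp
  linarith

lemma integrable_surface {F : Type*} [NormedAddCommGroup F] {f : S2 → F} (hf : Continuous f) :
    Integrable f surface :=
  hf.integrable_of_hasCompactSupport (HasCompactSupport.of_compactSpace f)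

/-- Archimedes' hat-box theorem: the height `z` is uniformly distributed on the sphere. -/
lemma integral_surface_polynomial (p : ℝ[X]) :
    ∫ v : S2, p.eval ((v : E3) 2) ∂surface = 2 * Real.pi * intervalInt p := by
  induction p using Polynomial.induction_on' with
  | add p q hp hq =>
    simp only [eval_add]
    rw [integral_add (integrable_surface (by fun_prop)) (integrable_surface (by fun_prop)), hp, hq,
      map_add]
    ring
  | monomial n a =>
    simp only [eval_monomial]
    rw [integral_const_mul, integral_surface_pow, ← C_mul_X_pow_eq_monomial, intervalInt_C_mul]
    ring

lemma rotate_mul (R R' : Rot3) (x : E3) : rotate (R * R') x = rotate R (rotate R' x) := by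
  simp [rotate, Matrix.mulVec_mulVec]

lemma rotate_one (x : E3) : rotate 1 x = x := by
  simp [rotate]

lemma rotate_smul (R : Rot3) (c : ℝ) (x : E3) : rotate R (c • x) = c • rotate R x := by
  simp [rotate, Matrix.mulVec_smul]

lemma norm_rotate (R : Rot3) (x : E3) : ‖rotate R x‖ = ‖x‖ := by
  have hR : (R : Matrix (Fin 3) (Fin 3) ℝ).transpose * (R : Matrix (Fin 3) (Fin 3) ℝ) = 1 :=
    (Matrix.mem_orthogonalGroup_iff' (Fin 3) ℝ).1 (Matrix.mem_specialOrthogonalGroup_iff.1 R.2).1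
  have h : ‖rotate R x‖ ^ 2 = ‖x‖ ^ 2 := by
    have e : ∀ y : E3, ‖y‖ ^ 2 = dotProduct y.ofLp y.ofLp := fun y => by
      rw [EuclideanSpace.norm_sq_eq]
      simp [dotProduct, ← sq]
    rw [e, e, rotate]
    rw [Matrix.dotProduct_mulVec, Matrix.vecMul_mulVec, ← Matrix.dotProduct_mulVec]
    simp [hR]
  exact (sq_eq_sq₀ (norm_nonneg _) (norm_nonneg _)).1 h

/-- A rotation as a linear isometry. -/
noncomputable def rotateIsometry (R : Rot3) : E3 ≃ₗᵢ[ℝ] E3 where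
  toFun := rotate R
  invFun := rotate R⁻¹
  left_inv x := by rw [← rotate_mul, inv_mul_cancel, rotate_one]
  right_inv x := by rw [← rotate_mul, mul_inv_cancel, rotate_one]
  map_add' x y := by simp [rotate, Matrix.mulVec_add]
  map_smul' := rotate_smul R
  norm_map' := norm_rotate R

lemma rotateIsometry_apply (R : Rot3) (x : E3) : rotateIsometry R x = rotate R x := rfl

/-- Rotations preserve Lebesgue measure and the norm, so both surface integrals agree after
multiplication by the same nonzero radial Gaussian factor. -/
lemma integral_surface_rotate (R : Rot3) (f : E3 → ℂ) :
    ∫ v : S2, f (rotate R v) ∂surface = ∫ v : S2, f v ∂surface := by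
  have h1 := integral_mul_fun_norm f (fun r => ((Real.exp (-r ^ 2) : ℝ) : ℂ))
  have h2 := integral_mul_fun_norm (fun v => f (rotate R v))
    (fun r => ((Real.exp (-r ^ 2) : ℝ) : ℂ))
  have h3 := (rotateIsometry R).measurePreserving.integral_comp
    (rotateIsometry R).toHomeomorph.measurableEmbedding
    (fun x : E3 => f (‖x‖⁻¹ • x) * ((Real.exp (-‖x‖ ^ 2) : ℝ) : ℂ))
  simp only [rotateIsometry_apply, norm_rotate, ← rotate_smul] at h3
  rw [h1, h2] at h3
  refine mul_right_cancel₀ ?_ h3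
  have h4 : ∫ r in Set.Ioi (0 : ℝ), (((r ^ 2 : ℝ) : ℂ)) * ((Real.exp (-r ^ 2) : ℝ) : ℂ) =
      ((gaussMoment 2 : ℝ) : ℂ) := by
    rw [gaussMoment, ← integral_complex_ofReal]
    push_cast
    rfl
  change ∫ r in Set.Ioi (0 : ℝ), (((r ^ 2 : ℝ) : ℂ)) * ((Real.exp (-r ^ 2) : ℝ) : ℂ) ≠ 0
  rw [h4]
  exact_mod_cast (gaussMoment_pos 2).ne'

/-! ### Spherical harmonics as polynomial functions on the sphere -/

/-- Coordinate functions on the sphere. -/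
noncomputable def coordFun (i : Fin 3) : C(S2, ℂ) :=
  ⟨fun v => (((v : E3) i : ℝ) : ℂ), by fun_prop⟩

@[simp] lemma coordFun_apply (i : Fin 3) (v : S2) : coordFun i v = (((v : E3) i : ℝ) : ℂ) := rfl

/-- The functions `(x + i y) ^ m` for `m ≥ 0` and `(x - i y) ^ (-m)` for `m < 0`. -/
noncomputable def azimuthal (m : ℤ) : C(S2, ℂ) :=
  (coordFun 0 + (if 0 ≤ m then Complex.I else -Complex.I) • coordFun 1) ^ m.natAbs

/-- The zonal function `p(z)`. -/
noncomputable def zonal (p : ℝ[X]) : C(S2, ℂ) :=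
  ⟨fun v => ((p.eval ((v : E3) 2) : ℝ) : ℂ), by fun_prop⟩

@[simp] lemma zonal_apply (p : ℝ[X]) (v : S2) :
    zonal p v = ((p.eval ((v : E3) 2) : ℝ) : ℂ) := rfl

lemma zonal_add (p q : ℝ[X]) : zonal (p + q) = zonal p + zonal q := by ext; simp

lemma zonal_mul (p q : ℝ[X]) : zonal (p * q) = zonal p * zonal q := by ext; simp

lemma zonal_C_mul (a : ℝ) (p : ℝ[X]) : zonal (C a * p) = (a : ℂ) • zonal p := by ext; simp

lemma zonal_X_pow (n : ℕ) : zonal (X ^ n) = coordFun 2 ^ n := by ext; simp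

lemma zonal_one : zonal 1 = 1 := by ext; simp

lemma star_zonal (p : ℝ[X]) : star (zonal p) = zonal p := by ext; simp

lemma sphere_sq_sum (v : S2) :
    ((v : E3) 0) ^ 2 + ((v : E3) 1) ^ 2 + ((v : E3) 2) ^ 2 = 1 := by
  have h : ‖(v : E3)‖ ^ 2 = 1 := by simp
  rw [EuclideanSpace.norm_sq_eq] at h
  simpa [Fin.sum_univ_three] using h

lemma azimuthal_zero : azimuthal 0 = 1 := by simp [azimuthal]

lemma azimuthal_natCast (n : ℕ) :
    azimuthal n = (coordFun 0 + Complex.I • coordFun 1) ^ n := by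
  simp [azimuthal]

lemma azimuthal_neg_natCast (n : ℕ) :
    azimuthal (-n) = (coordFun 0 - Complex.I • coordFun 1) ^ n := by
  rcases n with _ | n
  · simp [azimuthal]
  · have : ¬ (0 : ℤ) ≤ -((n + 1 : ℕ) : ℤ) := by push_cast; omega
    rw [azimuthal, if_neg this, Int.natAbs_neg, Int.natAbs_natCast]
    congr 1
    ext v
    simp [sub_eq_add_neg]

lemma star_azimuthal (m : ℤ) : star (azimuthal m) = azimuthal (-m) := by
  obtain ⟨n, rfl | rfl⟩ := m.eq_nat_or_neg
  · rw [azimuthal_neg_natCast, azimuthal_natCast]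
    ext v
    simp [sub_eq_add_neg]
  · rw [neg_neg, azimuthal_neg_natCast, azimuthal_natCast]
    ext v
    simp [sub_eq_add_neg]

lemma coordFun_mul_conj :
    (coordFun 0 + Complex.I • coordFun 1) * (coordFun 0 - Complex.I • coordFun 1) =
      zonal (1 - X ^ 2) := by
  ext v
  have h := congrArg (fun x : ℝ => (x : ℂ)) (sphere_sq_sum v)
  push_cast at h
  simp only [ContinuousMap.mul_apply, ContinuousMap.add_apply, ContinuousMap.sub_apply,
    ContinuousMap.smul_apply, coordFun_apply, zonal_apply, smul_eq_mul, eval_sub, eval_one,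
    eval_pow, eval_X]
  push_cast
  linear_combination h - ((v : E3) 1 : ℂ) ^ 2 * Complex.I_sq

lemma zonal_pow (p : ℝ[X]) (n : ℕ) : zonal (p ^ n) = zonal p ^ n := by ext; simp

lemma star_azimuthal_mul_self (m : ℤ) :
    star (azimuthal m) * azimuthal m = zonal ((1 - X ^ 2) ^ m.natAbs) := by
  rw [star_azimuthal]
  obtain ⟨n, rfl | rfl⟩ := m.eq_nat_or_neg
  · rw [azimuthal_neg_natCast, azimuthal_natCast, ← mul_pow, mul_comm (_ - _), coordFun_mul_conj,
      zonal_pow, Int.natAbs_natCast]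
  · rw [neg_neg, azimuthal_neg_natCast, azimuthal_natCast, ← mul_pow, coordFun_mul_conj,
      zonal_pow, Int.natAbs_neg, Int.natAbs_natCast]

/-- The constant factor of `y_{lm}`. -/
noncomputable def harmCoeff (l : ℕ) (m : ℤ) : ℝ :=
  shNorm l m * ((if 0 ≤ m then 1
    else (-1) ^ m.natAbs * (((l - m.natAbs)! : ℕ) : ℝ) / (((l + m.natAbs)! : ℕ) : ℝ)) *
      (-1) ^ m.natAbs)

/-- Spherical harmonics as continuous functions on the sphere. -/
noncomputable def harm (l : ℕ) (m : ℤ) : C(S2, ℂ) :=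
  (harmCoeff l m : ℂ) • (zonal (derivative^[m.natAbs] (legendreP l)) * azimuthal m)

/-- On the sphere `√(1 - z²) = |x + i y|`, so this is the polar form of a power of `x + i y` or of
its conjugate. It turns the trigonometric definition of `y_lm` into a polynomial one. -/
lemma azimuthal_apply (m : ℤ) (v : S2) :
    azimuthal m v = ((Real.sqrt (1 - ((v : E3) 2) ^ 2) ^ m.natAbs : ℝ) : ℂ) *
      Complex.exp (Complex.I * (m : ℂ) *
        (Complex.arg (((v : E3) 0 : ℂ) + Complex.I * ((v : E3) 1 : ℂ)) : ℂ)) := by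
  set w : ℂ := ((v : E3) 0 : ℂ) + Complex.I * ((v : E3) 1 : ℂ) with hw
  have hn : Real.sqrt (1 - ((v : E3) 2) ^ 2) = ‖w‖ := by
    rw [Complex.norm_def, Complex.normSq_apply]
    congr 1
    simp only [hw, Complex.add_re, Complex.mul_re, Complex.add_im, Complex.mul_im,
      Complex.ofReal_re, Complex.ofReal_im, Complex.I_re, Complex.I_im]
    linarith [sphere_sq_sum v]
  have hexp : (‖w‖ : ℂ) * Complex.exp (Complex.arg w * Complex.I) = w :=
    Complex.norm_mul_exp_arg_mul_I w
  rw [hn]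
  obtain ⟨n, rfl | rfl⟩ := m.eq_nat_or_neg
  · have h1 : azimuthal n v = w ^ n := by
      rw [azimuthal_natCast]; simp [hw]
    rw [h1, Int.natAbs_natCast, Complex.ofReal_pow, ← hexp, mul_pow, ← Complex.exp_nat_mul]
    simp only [hexp]
    congr 2
    push_cast
    ring
  · have h1 : azimuthal (-n) v = (conj w) ^ n := by
      rw [azimuthal_neg_natCast]; simp [hw, sub_eq_add_neg]
    have h2 : conj w = (‖w‖ : ℂ) * Complex.exp (-(Complex.arg w * Complex.I)) := by
      conv_lhs => rw [← hexp]
      rw [map_mul, ← Complex.exp_conj]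
      simp
    rw [h1, Int.natAbs_neg, Int.natAbs_natCast, Complex.ofReal_pow, h2, mul_pow,
      ← Complex.exp_nat_mul]
    congr 2
    push_cast
    ring

lemma sphHarm_eq_harm (l : ℕ) (m : ℤ) (v : S2) : sphHarm l m v = harm l m v := by
  simp only [harm, ContinuousMap.smul_apply, ContinuousMap.mul_apply, azimuthal_apply, zonal_apply,
    smul_eq_mul, sphHarm, assocLegendre, harmCoeff]
  push_cast
  ring

lemma shNorm_sq (l n : ℕ) (hn : n ≤ l) :
    shNorm l n ^ 2 = (2 * (l : ℝ) + 1) / (4 * Real.pi) * ((l - n)! / (l + n)!) := by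
  rw [shNorm, Real.sq_sqrt (by positivity), show ((l : ℤ) - n).toNat = l - n by omega,
    show ((l : ℤ) + n).toNat = l + n by omega]
  ring

lemma shNorm_neg (l n : ℕ) (hn : n ≤ l) :
    (((l - n)! : ℕ) : ℝ) / (((l + n)! : ℕ) : ℝ) * shNorm l (-n) = shNorm l n := by
  have h0 : (0 : ℝ) ≤ (((l - n)! : ℕ) : ℝ) / (((l + n)! : ℕ) : ℝ) := by positivity
  rw [shNorm, shNorm, ← Real.sqrt_sq h0, ← Real.sqrt_mul (by positivity),
    show ((l : ℤ) - n).toNat = l - n by omega, show ((l : ℤ) + n).toNat = l + n by omega,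
    show ((l : ℤ) - -n).toNat = l + n by omega, show ((l : ℤ) + -n).toNat = l - n by omega]
  congr 1
  have : ((l - n)! : ℝ) ≠ 0 := by positivity
  have : ((l + n)! : ℝ) ≠ 0 := by positivity
  field_simp

lemma harmCoeff_natCast (l n : ℕ) : harmCoeff l n = (-1) ^ n * shNorm l n := by
  simp [harmCoeff, mul_comm]

lemma harmCoeff_neg_natCast (l n : ℕ) (hn : n ≤ l) : harmCoeff l (-n) = shNorm l n := by
  rcases n with _ | n
  · simp [harmCoeff]
  · have : ¬ (0 : ℤ) ≤ -((n + 1 : ℕ) : ℤ) := by push_cast; omega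
    rw [harmCoeff, if_neg this, ← shNorm_neg l (n + 1) hn, Int.natAbs_neg, Int.natAbs_natCast]
    have : ((-1 : ℝ) ^ (n + 1)) * (-1) ^ (n + 1) = 1 := by rw [← mul_pow]; simp
    linear_combination (shNorm l (-((n + 1 : ℕ) : ℤ)) * (((l - (n + 1))! : ℕ) : ℝ) /
      (((l + (n + 1))! : ℕ) : ℝ)) * this

lemma harmCoeff_neg (l : ℕ) (m : ℤ) (hm : m.natAbs ≤ l) :
    harmCoeff l (-m) = (-1) ^ m.natAbs * harmCoeff l m := by
  obtain ⟨n, rfl | rfl⟩ := m.eq_nat_or_neg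
  · rw [harmCoeff_neg_natCast l n (by simpa using hm), harmCoeff_natCast, Int.natAbs_natCast,
      ← mul_assoc, ← mul_pow]
    simp
  · rw [neg_neg, harmCoeff_neg_natCast l n (by simpa using hm), harmCoeff_natCast, Int.natAbs_neg,
      Int.natAbs_natCast]

lemma harmCoeff_sq (l : ℕ) (m : ℤ) (hm : m.natAbs ≤ l) :
    harmCoeff l m ^ 2 =
      (2 * (l : ℝ) + 1) / (4 * Real.pi) * ((l - m.natAbs)! / (l + m.natAbs)!) := by
  obtain ⟨n, rfl | rfl⟩ := m.eq_nat_or_neg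
  · rw [harmCoeff_natCast, mul_pow, shNorm_sq l n (by simpa using hm), ← pow_mul, mul_comm n,
      pow_mul]
    simp
  · rw [harmCoeff_neg_natCast l n (by simpa using hm), shNorm_sq l n (by simpa using hm)]
    simp

lemma harmCoeff_ne_zero (l : ℕ) (m : ℤ) (hm : m.natAbs ≤ l) : harmCoeff l m ≠ 0 := by
  have h : 0 < harmCoeff l m ^ 2 := by rw [harmCoeff_sq l m hm]; positivity
  exact fun h0 => by simp [h0] at h

lemma star_harm (l : ℕ) (m : ℤ) (hm : m.natAbs ≤ l) :
    star (harm l m) = ((-1 : ℂ) ^ m.natAbs) • harm l (-m) := by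
  rw [harm, harm, harmCoeff_neg l m hm, star_smul, star_mul, star_zonal, star_azimuthal,
    Int.natAbs_neg, smul_smul]
  push_cast
  rw [← mul_assoc, ← mul_pow, mul_comm (azimuthal (-m))]
  simp

lemma harm_zero_zero : harm 0 0 = ((1 / Real.sqrt (4 * Real.pi) : ℝ) : ℂ) • 1 := by
  have : harmCoeff 0 0 = 1 / Real.sqrt (4 * Real.pi) := by
    simp [harmCoeff, shNorm, Real.sqrt_inv]
  rw [harm, this, azimuthal_zero]
  simp [legendreP, zonal_one]

/-! ### Inner product on the sphere, rotations, orthonormality -/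

/-- Integration over the sphere as a linear functional. -/
noncomputable def surfInt : C(S2, ℂ) →ₗ[ℂ] ℂ where
  toFun f := ∫ v : S2, f v ∂surface
  map_add' f g := integral_add (integrable_surface f.continuous) (integrable_surface g.continuous)
  map_smul' c _ := integral_const_mul c _

lemma surfInt_apply (f : C(S2, ℂ)) : surfInt f = ∫ v : S2, f v ∂surface := rfl

/-- The `L²` inner product on the sphere. -/
noncomputable def sphInner (f : C(S2, ℂ)) : C(S2, ℂ) →ₗ[ℂ] ℂ :=
  surfInt ∘ₗ LinearMap.mulLeft ℂ (star f)

lemma sphInner_apply (f g : C(S2, ℂ)) : sphInner f g = surfInt (star f * g) := rfl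

lemma sphInner_smul_left (c : ℂ) (f g : C(S2, ℂ)) :
    sphInner (c • f) g = conj c * sphInner f g := by
  rw [sphInner_apply, star_smul, smul_mul_assoc, map_smul]
  rfl

lemma sphInner_conj (f g : C(S2, ℂ)) : conj (sphInner f g) = sphInner g f := by
  simp only [sphInner_apply, surfInt_apply]
  rw [← integral_conj]
  congr 1
  ext v
  simp [mul_comm]

lemma surfInt_zonal (p : ℝ[X]) :
    surfInt (zonal p) = ((2 * Real.pi * intervalInt p : ℝ) : ℂ) := by
  rw [surfInt_apply, ← integral_surface_polynomial, ← integral_complex_ofReal]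
  rfl

/-- A rotation as a self-map of the sphere. -/
noncomputable def rotateSphere (R : Rot3) : C(S2, S2) where
  toFun v := ⟨rotate R v, by simp [norm_rotate]⟩
  continuous_toFun :=
    Continuous.subtype_mk ((rotateIsometry R).continuous.comp continuous_subtype_val) _

/-- Pullback of functions on the sphere under a rotation. -/
noncomputable def pullback (R : Rot3) : C(S2, ℂ) →ₐ[ℂ] C(S2, ℂ) :=
  ContinuousMap.compRightAlgHom ℂ ℂ (rotateSphere R)

lemma pullback_apply (R : Rot3) (f : C(S2, ℂ)) (v : S2) :
    pullback R f v = f (rotateSphere R v) := rfl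

lemma pullback_inv_pullback (R : Rot3) (f : C(S2, ℂ)) : pullback R (pullback R⁻¹ f) = f := by
  ext v
  rw [pullback_apply, pullback_apply]
  congr 1
  ext1
  change rotate R⁻¹ (rotate R v) = v
  rw [← rotate_mul, inv_mul_cancel, rotate_one]

lemma star_pullback (R : Rot3) (f : C(S2, ℂ)) : star (pullback R f) = pullback R (star f) := rfl

lemma surfInt_pullback (R : Rot3) (f : C(S2, ℂ)) : surfInt (pullback R f) = surfInt f := by
  have h := integral_surface_rotate R (Function.extend Subtype.val f 0)
  have e : ∀ v : S2, Function.extend Subtype.val f 0 (v : E3) = f v := fun v =>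
    Subtype.val_injective.extend_apply _ _ _
  rw [surfInt_apply, surfInt_apply]
  simp only [e] at h
  rw [← h]
  congr 1
  ext v
  exact (e (rotateSphere R v)).symm

lemma sphInner_pullback (R : Rot3) (f g : C(S2, ℂ)) :
    sphInner (pullback R f) (pullback R g) = sphInner f g := by
  rw [sphInner_apply, star_pullback, ← map_mul, surfInt_pullback, sphInner_apply]

/-- Rotation about the third axis. -/
noncomputable def rotZ (α : ℝ) : Rot3 :=
  ⟨!![Real.cos α, -Real.sin α, 0; Real.sin α, Real.cos α, 0; 0, 0, 1], by
    rw [Matrix.mem_specialOrthogonalGroup_iff, Matrix.mem_orthogonalGroup_iff]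
    have := Real.cos_sq_add_sin_sq α
    constructor
    · ext i j
      fin_cases i <;> fin_cases j <;>
        simp [Matrix.mul_apply, Fin.sum_univ_three] <;> linarith
    · rw [Matrix.det_fin_three]
      simp
      linarith⟩

lemma pullback_rotZ_zonal (α : ℝ) (p : ℝ[X]) : pullback (rotZ α) (zonal p) = zonal p := by
  ext v
  simp [pullback_apply, rotateSphere, rotate, rotZ, dotProduct, Fin.sum_univ_three]

/-- Rotation by `α` about the third axis multiplies `x + i y` by `e^{iα}` and `x - i y` by
`e^{-iα}`. -/
lemma pullback_rotZ_azimuthal (α : ℝ) (m : ℤ) :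
    pullback (rotZ α) (azimuthal m) = Complex.exp (Complex.I * m * α) • azimuthal m := by
  have hc : Complex.exp (α * Complex.I) = Complex.cos α + Complex.sin α * Complex.I :=
    Complex.exp_mul_I α
  have hc' : Complex.exp (-α * Complex.I) = Complex.cos α - Complex.sin α * Complex.I := by
    rw [Complex.exp_mul_I, Complex.cos_neg, Complex.sin_neg]; ring
  obtain ⟨n, rfl | rfl⟩ := m.eq_nat_or_neg
  · rw [azimuthal_natCast, map_pow, show Complex.I * ((n : ℤ) : ℂ) * α = n * (α * Complex.I) by
      push_cast; ring, Complex.exp_nat_mul, ← _root_.smul_pow, hc]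
    congr 1
    ext v
    simp [pullback_apply, rotateSphere, rotate, rotZ, dotProduct,
      Fin.sum_univ_three]
    linear_combination (-Complex.sin α * ((v : E3) 1 : ℂ)) * Complex.I_sq
  · rw [azimuthal_neg_natCast, map_pow, show Complex.I * ((-(n : ℤ) : ℤ) : ℂ) * α =
      n * (-α * Complex.I) by push_cast; ring, Complex.exp_nat_mul, ← _root_.smul_pow, hc']
    congr 1
    ext v
    simp [pullback_apply, rotateSphere, rotate, rotZ, dotProduct,
      Fin.sum_univ_three]
    linear_combination (-Complex.sin α * ((v : E3) 1 : ℂ)) * Complex.I_sq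

lemma pullback_rotZ_harm (α : ℝ) (l : ℕ) (m : ℤ) :
    pullback (rotZ α) (harm l m) = Complex.exp (Complex.I * m * α) • harm l m := by
  rw [harm, map_smul, map_mul, pullback_rotZ_zonal, pullback_rotZ_azimuthal, mul_smul_comm,
    smul_comm]

/-- Harmonics of different orders have different characters under rotations about the third axis,
which preserve the inner product. -/
lemma sphInner_harm_of_ne (l l' : ℕ) {m m' : ℤ} (h : m ≠ m') :
    sphInner (harm l m) (harm l' m') = 0 := by
  have hd : ((m' : ℂ) - m) ≠ 0 := by
    rw [sub_ne_zero]; exact_mod_cast h.symm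
  -- With this angle the relative phase is `e^{iπ} = -1`, so the inner product equals its own
  -- negative.
  set α : ℝ := Real.pi / (m' - m) with hα
  have h1 := sphInner_pullback (rotZ α) (harm l m) (harm l' m')
  rw [pullback_rotZ_harm, pullback_rotZ_harm, map_smul, sphInner_smul_left, ← Complex.exp_conj,
    smul_eq_mul, ← mul_assoc, ← Complex.exp_add] at h1
  have h2 : Complex.I * m' * α + conj (Complex.I * m * α) = Real.pi * Complex.I := by
    rw [hα]
    simp only [map_mul, Complex.conj_I, Complex.conj_ofReal, map_intCast]
    push_cast
    field_simp
    ring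
  rw [h2, Complex.exp_pi_mul_I] at h1
  linear_combination (-1 / 2 : ℂ) * h1

/-- For equal orders the azimuthal factors multiply to `(1 - z²)^|m|`, leaving a zonal integral,
namely the associated Legendre one. -/
lemma sphInner_harm (l l' : ℕ) (m m' : ℤ) (hm : m.natAbs ≤ l) :
    sphInner (harm l m) (harm l' m') = if l = l' ∧ m = m' then 1 else 0 := by
  by_cases h : m = m'
  swap
  · rw [sphInner_harm_of_ne _ _ h, if_neg (fun h' => h h'.2)]
  subst h
  have e : star (harm l m) * harm l' m = ((harmCoeff l m * harmCoeff l' m : ℝ) : ℂ) •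
      zonal ((1 - X ^ 2) ^ m.natAbs * derivative^[m.natAbs] (legendreP l) *
        derivative^[m.natAbs] (legendreP l')) := by
    rw [harm, harm, star_smul, star_mul, star_zonal, zonal_mul, zonal_mul, ← star_azimuthal_mul_self,
      smul_mul_smul_comm, Complex.ofReal_mul]
    congr 1
    · simp
    · ring
  rw [sphInner_apply, e, map_smul, surfInt_zonal, intervalInt_assocLegendre _ _ _ hm]
  by_cases hl : l = l'
  · subst hl
    simp only [if_true, and_self]
    rw [smul_eq_mul, ← Complex.ofReal_mul, ← sq, harmCoeff_sq l m hm]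
    rw [← Complex.ofReal_one]
    congr 1
    have : ((l - m.natAbs)! : ℝ) ≠ 0 := by positivity
    have : ((l + m.natAbs)! : ℝ) ≠ 0 := by positivity
    have : (2 * (l : ℝ) + 1) ≠ 0 := by positivity
    have := Real.pi_ne_zero
    field_simp
    norm_num
  · simp [hl]

/-! ### Polynomials on the sphere are spanned by harmonics -/

/-- Restrictions to the sphere of polynomials of degree at most one. -/
noncomputable def affineFuns : Submodule ℂ C(S2, ℂ) :=
  Submodule.span ℂ (insert 1 (Set.range coordFun))

lemma one_mem_affineFuns : (1 : C(S2, ℂ)) ∈ affineFuns := Submodule.subset_span (by simp)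

lemma coordFun_mem_affineFuns (i : Fin 3) : coordFun i ∈ affineFuns :=
  Submodule.subset_span (by simp)

lemma affineFuns_pow_mono {m n : ℕ} (h : m ≤ n) : affineFuns ^ m ≤ affineFuns ^ n :=
  pow_le_pow_right₀ (Submodule.one_le.2 one_mem_affineFuns) h

lemma pullback_coordFun (R : Rot3) (i : Fin 3) :
    pullback R (coordFun i) =
      ∑ j, (((R : Matrix (Fin 3) (Fin 3) ℝ) i j : ℝ) : ℂ) • coordFun j := by
  ext v
  simp [pullback_apply, rotateSphere, rotate, Matrix.mulVec, dotProduct, Fin.sum_univ_three]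

/-- `affineFuns ^ n` consists of the polynomial functions of degree at most `n`. Pullback is an
algebra map that sends coordinates to linear combinations of coordinates, so it does not raise the
degree. -/
lemma pullback_mem_affineFuns_pow (R : Rot3) {n : ℕ} {f : C(S2, ℂ)} (hf : f ∈ affineFuns ^ n) :
    pullback R f ∈ affineFuns ^ n := by
  have h1 : affineFuns.map (pullback R).toLinearMap ≤ affineFuns := by
    rw [affineFuns, Submodule.map_span_le]
    rintro f (rfl | ⟨i, rfl⟩)
    · change pullback R 1 ∈ affineFuns
      rw [map_one]
      exact one_mem_affineFuns
    · change pullback R (coordFun i) ∈ affineFuns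
      rw [pullback_coordFun]
      exact Submodule.sum_mem _ fun j _ => Submodule.smul_mem _ _ (coordFun_mem_affineFuns j)
  have h2 : (affineFuns ^ n).map (pullback R).toLinearMap ≤ affineFuns ^ n := by
    rw [Submodule.map_pow]
    exact pow_le_pow_left' h1 n
  exact h2 (Submodule.mem_map_of_mem hf)

lemma zonal_mem (p : ℝ[X]) {n : ℕ} (hp : p.natDegree ≤ n) : zonal p ∈ affineFuns ^ n := by
  have e : zonal p = ∑ i ∈ Finset.range (p.natDegree + 1), ((p.coeff i : ℝ) : ℂ) • coordFun 2 ^ i := by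
    ext v
    simp [eval_eq_sum_range]
  rw [e]
  refine Submodule.sum_mem _ fun i hi => Submodule.smul_mem _ _ ?_
  refine affineFuns_pow_mono ?_ (Submodule.pow_mem_pow _ (coordFun_mem_affineFuns 2) i)
  rw [Finset.mem_range] at hi
  omega

lemma azimuthal_mem (m : ℤ) : azimuthal m ∈ affineFuns ^ m.natAbs :=
  Submodule.pow_mem_pow _ (Submodule.add_mem _ (coordFun_mem_affineFuns 0)
    (Submodule.smul_mem _ _ (coordFun_mem_affineFuns 1))) _

lemma harm_mem (l : ℕ) (m : ℤ) (hm : m.natAbs ≤ l) : harm l m ∈ affineFuns ^ l := by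
  have h := Submodule.mul_mem_mul
    (zonal_mem _ (natDegree_iterate_derivative_legendreP_le l m.natAbs)) (azimuthal_mem m)
  rw [← pow_add, Nat.sub_add_cancel hm] at h
  exact Submodule.smul_mem _ _ h

/-- The span of the spherical harmonics of degree at most `n`. -/
noncomputable def harmSpan (n : ℕ) : Submodule ℂ C(S2, ℂ) :=
  Submodule.span ℂ {f | ∃ (l : ℕ) (m : ℤ), l ≤ n ∧ m.natAbs ≤ l ∧ f = harm l m}

/-- Remove the leading term of `p` with a multiple of the `|m|`-th derivative of `P_{|m|+c}`, which
has degree exactly `c`, and induct. Since `c` strictly bounds the degree, the total degree is at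
most `|m| + c - 1`; this is the `n + 1` in the bound. -/
lemma zonal_mul_azimuthal_mem_harmSpan (m : ℤ) (c : ℕ) {n : ℕ} (hn : m.natAbs + c ≤ n + 1)
    (p : ℝ[X]) (hp : p.degree < c) : zonal p * azimuthal m ∈ harmSpan n := by
  induction c generalizing p with
  | zero =>
    have : p = 0 := by simpa using hp
    subst this
    have : zonal 0 = 0 := by ext; simp
    simp [this]
  | succ c ih =>
    set q := derivative^[m.natAbs] (legendreP (m.natAbs + c)) with hq
    have hqc : q.coeff c ≠ 0 := coeff_iterate_derivative_legendreP_ne_zero _ _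
    have hqd : q.natDegree ≤ c :=
      (natDegree_iterate_derivative_legendreP_le _ _).trans (by omega)
    set a := p.coeff c / q.coeff c with ha
    have hr : (p - C a * q).degree < c := by
      rw [degree_lt_iff_coeff_zero]
      intro k hk
      rcases hk.eq_or_lt with rfl | hk
      · rw [coeff_sub, coeff_C_mul, ha, div_mul_cancel₀ _ hqc, sub_self]
      · rw [coeff_sub, coeff_C_mul, coeff_eq_zero_of_natDegree_lt (hqd.trans_lt hk),
          (degree_lt_iff_coeff_zero p (c + 1)).1 hp k hk]
        simp
    have h1 := ih (by omega) _ hr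
    have h2 : zonal q * azimuthal m ∈ harmSpan n := by
      have h3 : harm (m.natAbs + c) m ∈ harmSpan n :=
        Submodule.subset_span ⟨_, _, by omega, by omega, rfl⟩
      have h4 : ((harmCoeff (m.natAbs + c) m : ℝ) : ℂ) ≠ 0 := by
        exact_mod_cast harmCoeff_ne_zero _ _ (by omega)
      have h5 := Submodule.smul_mem (harmSpan n) ((harmCoeff (m.natAbs + c) m : ℝ) : ℂ)⁻¹ h3
      rwa [harm, smul_smul, inv_mul_cancel₀ h4, one_smul] at h5
    have e : zonal p * azimuthal m =
        zonal (p - C a * q) * azimuthal m + (a : ℂ) • (zonal q * azimuthal m) := by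
      rw [← smul_mul_assoc, ← zonal_C_mul, ← add_mul, ← zonal_add]
      congr 2
      ring
    rw [e]
    exact Submodule.add_mem _ h1 (Submodule.smul_mem _ _ h2)

lemma zonal_mul_azimuthal_mem (p : ℝ[X]) (m : ℤ) {n : ℕ} (h : m.natAbs + p.natDegree ≤ n) :
    zonal p * azimuthal m ∈ harmSpan n :=
  zonal_mul_azimuthal_mem_harmSpan m (p.natDegree + 1) (by omega) p
    (degree_le_natDegree.trans_lt (by exact_mod_cast Nat.lt_succ_self _))

lemma zero_smul_fun (f : C(S2, ℂ)) : (0 : ℂ) • f = 0 := zero_smul ℂ f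

lemma add_smul_fun (a b : ℂ) (f : C(S2, ℂ)) : (a + b) • f = a • f + b • f := add_smul a b f

lemma natDegree_mul_one_sub_sq_le (p : ℝ[X]) : (p * (1 - X ^ 2)).natDegree ≤ p.natDegree + 2 := by
  refine natDegree_mul_le.trans (Nat.add_le_add_left ?_ _)
  exact (natDegree_sub_le _ _).trans (by simp)

/-- For `m ≥ 0` the factor `x + i y` raises the order. For `m < 0` it meets a factor `x - i y` and
produces `1 - z²`, trading one unit of order for two of degree in `z`. -/
lemma add_smul_mul_mem_harmSpan (p : ℝ[X]) (m : ℤ) {n : ℕ} (h : m.natAbs + p.natDegree ≤ n) :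
    (coordFun 0 + Complex.I • coordFun 1) * (zonal p * azimuthal m) ∈ harmSpan (n + 1) := by
  have hd := natDegree_mul_one_sub_sq_le p
  obtain ⟨k, rfl | rfl⟩ := m.eq_nat_or_neg
  · rw [azimuthal_natCast, mul_left_comm, ← pow_succ', ← azimuthal_natCast]
    exact zonal_mul_azimuthal_mem _ _ (by omega)
  · rcases k with _ | k
    · rw [azimuthal_neg_natCast, pow_zero, mul_one, mul_comm, 
        ← pow_one (coordFun 0 + Complex.I • coordFun 1), ← azimuthal_natCast]
      exact zonal_mul_azimuthal_mem _ _ (by simp at h ⊢; omega)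
    · rw [azimuthal_neg_natCast, mul_left_comm, pow_succ', ← mul_assoc (_ + _), coordFun_mul_conj,
        ← mul_assoc, ← zonal_mul, ← azimuthal_neg_natCast]
      exact zonal_mul_azimuthal_mem _ _ (by omega)

lemma sub_smul_mul_mem_harmSpan (p : ℝ[X]) (m : ℤ) {n : ℕ} (h : m.natAbs + p.natDegree ≤ n) :
    (coordFun 0 - Complex.I • coordFun 1) * (zonal p * azimuthal m) ∈ harmSpan (n + 1) := by
  have hd := natDegree_mul_one_sub_sq_le p
  obtain ⟨k, rfl | rfl⟩ := m.eq_nat_or_neg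
  · rcases k with _ | k
    · rw [azimuthal_natCast, pow_zero, mul_one, mul_comm, ← pow_one (coordFun 0 - Complex.I • coordFun 1),
        ← azimuthal_neg_natCast]
      exact zonal_mul_azimuthal_mem _ _ (by simp at h ⊢; omega)
    · rw [azimuthal_natCast, mul_left_comm, pow_succ', ← mul_assoc (_ - _), mul_comm (_ - _),
        coordFun_mul_conj, ← mul_assoc, ← zonal_mul, ← azimuthal_natCast]
      exact zonal_mul_azimuthal_mem _ _ (by omega)
  · rw [azimuthal_neg_natCast, mul_left_comm, ← pow_succ', ← azimuthal_neg_natCast]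
    exact zonal_mul_azimuthal_mem _ _ (by omega)

/-- The coordinates `x` and `y` are combinations of `x ± i y`, while `z` is absorbed into the zonal
factor. -/
lemma coordFun_mul_mem_harmSpan (i : Fin 3) (p : ℝ[X]) (m : ℤ) {n : ℕ}
    (h : m.natAbs + p.natDegree ≤ n) :
    coordFun i * (zonal p * azimuthal m) ∈ harmSpan (n + 1) := by
  have h1 := add_smul_mul_mem_harmSpan p m h
  have h2 := sub_smul_mul_mem_harmSpan p m h
  fin_cases i
  · have := Submodule.smul_mem _ (1 / 2 : ℂ) (Submodule.add_mem _ h1 h2)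
    convert! this using 1
    ext v
    simp
    ring
  · have := Submodule.smul_mem _ (-Complex.I / 2 : ℂ) (Submodule.sub_mem _ h1 h2)
    convert! this using 1
    ext v
    simp
    linear_combination (((v : E3) 1 : ℂ) * ((eval ((v : E3) 2) p : ℝ) : ℂ) * azimuthal m v) *
      Complex.I_sq
  · have e : coordFun 2 * (zonal p * azimuthal m) = zonal (X * p) * azimuthal m := by
      rw [zonal_mul, ← mul_assoc, ← pow_one X, zonal_X_pow, pow_one]
    change coordFun 2 * (zonal p * azimuthal m) ∈ harmSpan (n + 1)
    rw [e]
    refine zonal_mul_azimuthal_mem _ _ ?_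
    have := natDegree_mul_le (p := (X : ℝ[X])) (q := p)
    rw [natDegree_X] at this
    omega

/-- Every polynomial function on the sphere is a combination of spherical harmonics. -/
lemma affineFuns_pow_le_harmSpan (n : ℕ) : affineFuns ^ n ≤ harmSpan n := by
  induction n with
  | zero =>
    rw [pow_zero affineFuns, Submodule.one_le]
    have h := zonal_mul_azimuthal_mem 1 0 (n := 0) (by simp)
    rwa [zonal_one, azimuthal_zero, mul_one] at h
  | succ n ih =>
    rw [pow_succ' affineFuns]
    refine (mul_le_mul' le_rfl ih).trans ?_
    rw [affineFuns, harmSpan, Submodule.span_mul_span, Submodule.span_le]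
    rintro _ ⟨f, hf, g, ⟨l, m, hl, hm, rfl⟩, rfl⟩
    rcases hf with rfl | ⟨i, rfl⟩
    · simp only [one_mul]
      exact Submodule.subset_span ⟨l, m, by omega, hm, rfl⟩
    · simp only [harm, mul_smul_comm]
      refine Submodule.smul_mem _ _ (coordFun_mul_mem_harmSpan i _ m ?_)
      have := natDegree_iterate_derivative_legendreP_le l m.natAbs
      omega

/-! ### Harmonic expansion, Wigner matrices and the angular condition -/

lemma mem_Icc_iff_natAbs {l : ℕ} {m : ℤ} :
    m ∈ Finset.Icc (-(l : ℤ)) (l : ℤ) ↔ m.natAbs ≤ l := by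
  rw [Finset.mem_Icc]; omega

lemma eq_sum_sphInner {n : ℕ} {f : C(S2, ℂ)} (hf : f ∈ harmSpan n) :
    f = ∑ l ∈ Finset.range (n + 1), ∑ m ∈ Finset.Icc (-(l : ℤ)) (l : ℤ),
      sphInner (harm l m) f • harm l m := by
  induction hf using Submodule.span_induction with
  | mem f hf =>
    obtain ⟨l, m, hl, hm, rfl⟩ := hf
    rw [Finset.sum_eq_single_of_mem l (by simpa using by omega),
      Finset.sum_eq_single_of_mem m (mem_Icc_iff_natAbs.2 hm), sphInner_harm _ _ _ _ hm]
    · simp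
    · intro m' hm' hne
      rw [sphInner_harm _ _ _ _ (mem_Icc_iff_natAbs.1 hm')]
      simp [hne, zero_smul_fun]
    · intro l' _ hne
      refine Finset.sum_eq_zero fun m' hm' => ?_
      rw [sphInner_harm _ _ _ _ (mem_Icc_iff_natAbs.1 hm')]
      simp [hne, zero_smul_fun]
  | zero => simp [zero_smul_fun]
  | add f g _ _ hf hg =>
    conv_lhs => rw [hf, hg]
    simp only [map_add, add_smul_fun, Finset.sum_add_distrib]
  | smul c f _ hf =>
    conv_lhs => rw [hf]
    simp only [map_smul, smul_eq_mul, Finset.smul_sum, smul_smul]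

lemma sphInner_harm_eq_zero {l n : ℕ} (h : n < l) {m : ℤ} (hm : m.natAbs ≤ l) {f : C(S2, ℂ)}
    (hf : f ∈ harmSpan n) : sphInner (harm l m) f = 0 := by
  induction hf using Submodule.span_induction with
  | mem f hf =>
    obtain ⟨l', m', hl, hm', rfl⟩ := hf
    rw [sphInner_harm _ _ _ _ hm, if_neg (by omega)]
  | zero => simp
  | add f g _ _ hf hg => simp [hf, hg]
  | smul c f _ hf => simp [hf]

/-- Rotation does not raise the degree. It does not lower it either: a component in degree `l' < l`
would, after moving the rotation to the other side of the inner product, pair `harm l m` with a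
polynomial of degree at most `l'`. -/
lemma pullback_harm (R : Rot3) (l : ℕ) (m : ℤ) (hm : m.natAbs ≤ l) :
    pullback R (harm l m) = ∑ k ∈ Finset.Icc (-(l : ℤ)) (l : ℤ),
      sphInner (harm l k) (pullback R (harm l m)) • harm l k := by
  have h := eq_sum_sphInner (affineFuns_pow_le_harmSpan l
    (pullback_mem_affineFuns_pow R (harm_mem l m hm)))
  rw [Finset.sum_range_succ, Finset.sum_eq_zero, zero_add] at h
  · exact h
  · intro l' hl'
    rw [Finset.mem_range] at hl'
    refine Finset.sum_eq_zero fun k hk => ?_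
    have hk := mem_Icc_iff_natAbs.1 hk
    have h0 : sphInner (harm l m) (pullback R⁻¹ (harm l' k)) = 0 :=
      sphInner_harm_eq_zero hl' hm (affineFuns_pow_le_harmSpan l'
        (pullback_mem_affineFuns_pow R⁻¹ (harm_mem l' k hk)))
    rw [← sphInner_pullback R, pullback_inv_pullback, ← sphInner_conj, map_eq_zero] at h0
    rw [h0, zero_smul_fun]

lemma wignerD_eq_sphInner (R : Rot3) (l : ℕ) (m m' : ℤ) :
    wignerD R l m m' = sphInner (harm l m) (pullback R⁻¹ (harm l m')) := by
  rw [wignerD, sphereIntegral, sphInner_apply, surfInt_apply]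
  congr 1
  ext v
  rw [sphHarm_eq_harm]
  exact congrArg _ (sphHarm_eq_harm l m' (rotateSphere R⁻¹ v))

lemma sum_smul_fun {ι : Type*} (s : Finset ι) (a : ι → ℂ) (f : C(S2, ℂ)) :
    (∑ i ∈ s, a i) • f = ∑ i ∈ s, a i • f := by
  ext v
  simp [Finset.sum_mul]

/-- The combination of spherical harmonics with given coefficients. -/
noncomputable def window (L : ℕ) (c : ℕ → ℤ → ℂ) : C(S2, ℂ) :=
  ∑ l ∈ Finset.range (L + 1), ∑ m ∈ Finset.Icc (-(l : ℤ)) (l : ℤ), c l m • harm l m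

lemma angularWindow_eq_window (L : ℕ) (c : ℕ → ℤ → ℂ) (v : S2) :
    angularWindow L c v = window L c v := by
  simp [angularWindow, window, sphHarm_eq_harm]

lemma window_mem (L : ℕ) (c : ℕ → ℤ → ℂ) : window L c ∈ affineFuns ^ L := by
  refine Submodule.sum_mem _ fun l hl => Submodule.sum_mem _ fun m hm => Submodule.smul_mem _ _ ?_
  refine affineFuns_pow_mono ?_ (harm_mem l m (mem_Icc_iff_natAbs.1 hm))
  rw [Finset.mem_range] at hl
  omega

/-- Identifies `γ(R⁻¹ ·)` with the window whose coefficients are transformed by the Wigner matrices.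
-/
lemma pullback_window (R : Rot3) (L : ℕ) (κ : ℕ → ℤ → ℂ) :
    pullback R⁻¹ (window L κ) = window L (rotCoeff R κ) := by
  simp only [window, map_sum, map_smul, rotCoeff]
  refine Finset.sum_congr rfl fun l _ => ?_
  simp only [sum_smul_fun]
  rw [Finset.sum_comm]
  refine Finset.sum_congr rfl fun m hm => ?_
  rw [pullback_harm _ _ _ (mem_Icc_iff_natAbs.1 hm), Finset.smul_sum]
  refine Finset.sum_congr rfl fun k _ => ?_
  rw [wignerD_eq_sphInner, smul_smul, mul_comm]

/-- Reindexing by `m ↦ -m`, using the conjugation rule for the harmonics. -/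
lemma star_window (L : ℕ) (c : ℕ → ℤ → ℂ) : star (window L c) = window L (conjCoeff c) := by
  simp only [window, star_sum, star_smul]
  refine Finset.sum_congr rfl fun l _ => ?_
  refine Finset.sum_nbij' (fun m => -m) (fun m => -m) ?_ ?_ ?_ ?_ ?_
  · intro m hm; rw [Finset.mem_Icc] at hm ⊢; omega
  · intro m hm; rw [Finset.mem_Icc] at hm ⊢; omega
  · simp
  · simp
  · intro m hm
    rw [star_harm _ _ (mem_Icc_iff_natAbs.1 hm), smul_smul, conjCoeff, neg_neg, Int.natAbs_neg,
      mul_comm]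
    rfl

lemma shProd_eq (l₁ : ℕ) (m₁ : ℤ) (l₂ : ℕ) (m₂ : ℤ) (l : ℕ) (m : ℤ) :
    shProd l₁ m₁ l₂ m₂ l m = sphInner (harm l m) (harm l₁ m₁ * harm l₂ m₂) := by
  rw [shProd, sphereIntegral, sphInner_apply, surfInt_apply]
  congr 1
  ext v
  simp only [sphHarm_eq_harm, ContinuousMap.mul_apply, ContinuousMap.star_apply]
  rw [mul_comm]
  rfl

lemma window_eq_sum_SHIndex (L : ℕ) (c : ℕ → ℤ → ℂ) :
    window L c = ∑ p : SHIndex L, coeffVec L c p • harm p.1 p.2 := by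
  rw [Fintype.sum_sigma, window, Finset.sum_range]
  refine Finset.sum_congr rfl fun l _ => ?_
  exact (Finset.sum_coe_sort (Finset.Icc (-((l : ℕ) : ℤ)) ((l : ℕ) : ℤ))
    (fun m => c l m • harm l m)).symm

lemma dotProduct_shProdMatrix (L l : ℕ) (m : ℤ) (c d : ℕ → ℤ → ℂ) :
    dotProduct (coeffVec L c) (Matrix.mulVec (shProdMatrix L l m) (coeffVec L d)) =
      sphInner (harm l m) (window L c * window L d) := by
  rw [window_eq_sum_SHIndex, window_eq_sum_SHIndex, Finset.sum_mul_sum, map_sum]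
  simp only [dotProduct, Matrix.mulVec, Finset.mul_sum, map_sum]
  refine Finset.sum_congr rfl fun p _ => Finset.sum_congr rfl fun q _ => ?_
  rw [smul_mul_smul_comm, map_smul, ← shProd_eq]
  simp only [shProdMatrix, Matrix.of_apply, smul_eq_mul]
  ring

/-- The angular admissibility condition: the rotated windows form a partition of unity. -/
lemma sum_norm_sq_angularWindow (L : ℕ) (κ : ℕ → ℤ → ℂ) {M : ℕ} (R : Fin M → Rot3)
    (h : ∀ (l : ℕ) (m : ℤ), m ∈ Finset.Icc (-(l : ℤ)) (l : ℤ) →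
      ∑ t : Fin M, dotProduct (coeffVec L (conjCoeff (rotCoeff (R t) κ)))
          (Matrix.mulVec (shProdMatrix L l m) (coeffVec L (rotCoeff (R t) κ))) =
        if l = 0 ∧ m = 0 then ((Real.sqrt (4 * Real.pi) : ℝ) : ℂ) else 0)
    (v : E3) (hv : ‖v‖ = 1) :
    ∑ t : Fin M, ‖angularWindow L κ (rotate (R t)⁻¹ v)‖ ^ 2 = 1 := by
  set F : C(S2, ℂ) := ∑ t, window L (conjCoeff (rotCoeff (R t) κ)) * window L (rotCoeff (R t) κ)
    with hF
  -- Products of two windows have degree at most `2L`, so finitely many coefficients determine `F`.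
  have hmem : F ∈ harmSpan (L + L) := by
    refine affineFuns_pow_le_harmSpan _ (Submodule.sum_mem _ fun t _ => ?_)
    rw [pow_add affineFuns]
    exact Submodule.mul_mem_mul (window_mem _ _) (window_mem _ _)
  have hF1 : F = 1 := by
    rw [eq_sum_sphInner hmem]
    have e : ∀ l ∈ Finset.range (L + L + 1), ∀ m ∈ Finset.Icc (-(l : ℤ)) (l : ℤ),
        sphInner (harm l m) F • harm l m =
          (if l = 0 ∧ m = 0 then ((Real.sqrt (4 * Real.pi) : ℝ) : ℂ) else 0) • harm l m := by
      intro l _ m hm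
      rw [← h l m hm, hF, map_sum]
      simp only [dotProduct_shProdMatrix]
    rw [Finset.sum_congr rfl fun l hl => Finset.sum_congr rfl (e l hl),
      Finset.sum_eq_single_of_mem 0 (by simp)]
    -- Only the degree zero term survives, and `√(4π) y_00 = 1`.
    · have : ((Real.sqrt (4 * Real.pi) : ℝ) : ℂ) ≠ 0 := by
        exact_mod_cast (Real.sqrt_pos.2 (by positivity)).ne'
      simp only [CharP.cast_eq_zero, neg_zero, Finset.Icc_self, Finset.sum_singleton, and_self,
        if_true, harm_zero_zero, smul_smul]
      push_cast
      rw [mul_one_div_cancel this, one_smul]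
    · intro l _ hl
      refine Finset.sum_eq_zero fun m _ => ?_
      simp [hl, zero_smul_fun]
  have hv' : v ∈ S2 := by simpa using hv
  have h1 := congrArg (fun f : C(S2, ℂ) => f ⟨v, hv'⟩) hF1
  simp only [hF, ContinuousMap.one_apply, ContinuousMap.coe_sum, Finset.sum_apply,
    ContinuousMap.mul_apply, ← star_window, ContinuousMap.star_apply] at h1
  have h2 : ∀ t, angularWindow L κ (rotate (R t)⁻¹ v) = window L (rotCoeff (R t) κ) ⟨v, hv'⟩ := by
    intro t
    rw [← pullback_window, pullback_apply, ← angularWindow_eq_window]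
    rfl
  have h3 : ((∑ t : Fin M, ‖angularWindow L κ (rotate (R t)⁻¹ v)‖ ^ 2 : ℝ) : ℂ) = 1 := by
    rw [← h1]
    push_cast
    refine Finset.sum_congr rfl fun t _ => ?_
    rw [h2, ← Complex.conj_mul']
    rfl
  exact_mod_cast h3

end DivFreeWavelet

namespace DivFreeWavelet

open scoped FourierTransform SchwartzMap LineDeriv

/-! ### Fourier integrals and the `L²` Fourier transform -/

lemma continuous_fourierInv {g : E3 → C3} (hg : Integrable g) : Continuous (𝓕⁻ g) :=
  VectorFourier.fourierIntegral_continuous Real.continuous_fourierChar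
    (L := -innerₗ E3) (by
      simp only [LinearMap.neg_apply, innerₗ_apply_apply]
      fun_prop) hg

lemma integral_smul_fourierInv (θ : 𝓢(E3, ℂ)) {g : E3 → C3} (hg : Integrable g) :
    ∫ x, θ x • (𝓕⁻ g) x = ∫ η, (𝓕⁻ θ) η • g η := by
  have h := VectorFourier.integral_fourierIntegral_smul_eq_flip (μ := (volume : Measure E3))
    (ν := (volume : Measure E3)) (L := -innerₗ E3) Real.continuous_fourierChar (by
      simp only [LinearMap.neg_apply, innerₗ_apply_apply]
      fun_prop) θ.integrable hg
  have e : (-innerₗ E3).flip = -innerₗ E3 := by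
    ext x y
    simp [real_inner_comm]
  rw [e] at h
  rw [SchwartzMap.fourierInv_coe]
  exact h.symm

/-- A compactly supported smooth real function as a complex Schwartz function. -/
noncomputable def testFun (g : E3 → ℝ) (h1 : ContDiff ℝ ∞ g) (h2 : HasCompactSupport g) :
    𝓢(E3, ℂ) :=
  HasCompactSupport.toSchwartzMap (f := Complex.ofRealCLM ∘ g) (h2.comp_left rfl) (by fun_prop)

lemma testFun_apply (g : E3 → ℝ) (h1 : ContDiff ℝ ∞ g) (h2 : HasCompactSupport g) (x : E3) :
    testFun g h1 h2 x = (g x : ℂ) := rfl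

/-- Both sides have the same integrals against smooth compactly supported functions: the `L²`
transform by its compatibility with tempered distributions, the integral by Fubini. -/
lemma fourierInv_toLp_ae {F : E3 → C3} (h1 : Integrable F) (h2 : MemLp F 2) :
    (𝓕⁻ (h2.toLp F) : Lp C3 2 (volume : Measure E3)) =ᵐ[volume] 𝓕⁻ F := by
  refine ae_eq_of_integral_contDiff_smul_eq
    ((Lp.memLp _).locallyIntegrable (by norm_num))
    (continuous_fourierInv h1).locallyIntegrable fun g hg1 hg2 => ?_
  have h3 := congrArg (fun T => T (testFun g hg1 hg2))
    (Lp.fourierInv_toTemperedDistribution_eq (h2.toLp F))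
  simp only [TemperedDistribution.fourierInv_apply, Lp.toTemperedDistribution_apply] at h3
  have h4 := integral_smul_fourierInv (testFun g hg1 hg2) h1
  simp only [testFun_apply, Complex.coe_smul] at h3 h4
  rw [← h3, h4]
  refine integral_congr_ae ?_
  filter_upwards [h2.coeFn_toLp] with x hx
  rw [hx]

lemma memLp_fourierInv {F : E3 → C3} (h1 : Integrable F) (h2 : MemLp F 2) :
    MemLp (𝓕⁻ F) 2 (volume : Measure E3) :=
  (Lp.memLp (𝓕⁻ (h2.toLp F) : Lp C3 2 (volume : Measure E3))).ae_eq (fourierInv_toLp_ae h1 h2)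

/-- The inverse Fourier integral represents the `L²` inverse Fourier transform. -/
lemma toLp_fourierInv {F : E3 → C3} (h1 : Integrable F) (h2 : MemLp F 2) :
    (memLp_fourierInv h1 h2).toLp (𝓕⁻ F) =
      (𝓕⁻ (h2.toLp F) : Lp C3 2 (volume : Measure E3)) := by
  exact Lp.ext ((memLp_fourierInv h1 h2).coeFn_toLp.trans (fourierInv_toLp_ae h1 h2).symm)

/-- Plancherel, in the form that moves the frame coefficients to frequency. -/
lemma inner_toLp_fourierInv {F : E3 → C3} (h1 : Integrable F) (h2 : MemLp F 2)
    (u : Lp C3 2 (volume : Measure E3)) :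
    inner ℂ ((memLp_fourierInv h1 h2).toLp (𝓕⁻ F)) u =
      inner ℂ (h2.toLp F) (𝓕 u : Lp C3 2 (volume : Measure E3)) := by
  rw [toLp_fourierInv h1 h2, ← Lp.inner_fourier_eq, FourierTransform.fourier_fourierInv_eq]

/-! ### Weak divergence in frequency -/

/-- The standard basis vectors of `E3`. -/
noncomputable abbrev basisVec (i : Fin 3) : E3 := EuclideanSpace.single i 1

lemma integrable_schwartz_smul {g : E3 → C3} (θ : 𝓢(E3, ℂ)) (hg : Integrable g) :
    Integrable (fun x => θ x • g x) := by
  refine hg.bdd_smul (C := ‖θ.toBoundedContinuousFunction‖) θ.continuous.aestronglyMeasurable ?_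
  exact Filter.Eventually.of_forall fun x => θ.toBoundedContinuousFunction.norm_coe_le_norm x

lemma integrable_schwartz_smul_fourierInv {g : E3 → C3} (θ : 𝓢(E3, ℂ)) (hg : Integrable g) :
    Integrable (fun x => θ x • (𝓕⁻ g) x) := by
  refine θ.integrable.smul_bdd (C := ∫ v, ‖g v‖)
    (continuous_fourierInv hg).aestronglyMeasurable ?_
  exact Filter.Eventually.of_forall fun x =>
    VectorFourier.norm_fourierIntegral_le_integral_norm _ _ _ _ _

/-- The inverse Fourier integral of a field orthogonal to the frequency is divergence-free. -/
lemma isDivFree_fourierInv {g : E3 → C3} (hg : Integrable g)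
    (h : ∀ η : E3, ∑ i, ((η i : ℝ) : ℂ) * g η i = 0) : IsDivFree (𝓕⁻ g) := by
  intro f hf1 hf2
  set θ := testFun f hf1 hf2
  have hd : ∀ x i, ((fderiv ℝ f x (basisVec i) : ℝ) : ℂ) = (∂_{basisVec i} θ) x := by
    intro x i
    rw [SchwartzMap.lineDerivOp_apply_eq_fderiv]
    change _ = fderiv ℝ (Complex.ofRealCLM ∘ f) x (basisVec i)
    rw [fderiv_comp x (by fun_prop) (hf1.differentiable (by simp) x)]
    simp
  have hcomp : ∀ i, ∫ x, ((fderiv ℝ f x (basisVec i) : ℝ) : ℂ) * (𝓕⁻ g) x i =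
      ∫ η, (𝓕⁻ (∂_{basisVec i} θ)) η * g η i := by
    intro i
    have h1 := congrArg (EuclideanSpace.proj i : C3 →L[ℂ] ℂ)
      (integral_smul_fourierInv (∂_{basisVec i} θ) hg)
    rw [← ContinuousLinearMap.integral_comp_comm _ (integrable_schwartz_smul_fourierInv _ hg),
      ← ContinuousLinearMap.integral_comp_comm _ (integrable_schwartz_smul _ hg)] at h1
    simp only [hd]
    simpa using h1
  have hint1 : ∀ i, Integrable fun x => ((fderiv ℝ f x (basisVec i) : ℝ) : ℂ) * (𝓕⁻ g) x i := by
    intro i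
    have := (EuclideanSpace.proj i : C3 →L[ℂ] ℂ).integrable_comp
      (integrable_schwartz_smul_fourierInv (∂_{basisVec i} θ) hg)
    simpa [hd] using this
  have hint2 : ∀ i, Integrable fun η => (𝓕⁻ (∂_{basisVec i} θ)) η * g η i := by
    intro i
    have := (EuclideanSpace.proj i : C3 →L[ℂ] ℂ).integrable_comp
      (integrable_schwartz_smul (𝓕⁻ (∂_{basisVec i} θ)) hg)
    simpa using this
  rw [integral_finsetSum _ fun i _ => hint1 i, Finset.sum_congr rfl fun i _ => hcomp i,
    ← integral_finsetSum _ fun i _ => hint2 i]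
  refine integral_eq_zero_of_ae (Filter.Eventually.of_forall fun η => ?_)
  -- Differentiation becomes multiplication by `-2πi η_i`, so the integrand is a multiple of `η ·
  -- g(η)`.
  have h2 : ∀ i, (𝓕⁻ (∂_{basisVec i} θ)) η =
      -(2 * Real.pi * Complex.I) * ((η i : ℝ) : ℂ) * (𝓕⁻ θ) η := by
    intro i
    rw [SchwartzMap.fourierInv_lineDerivOp_eq]
    rw [_root_.smul_apply, SchwartzMap.smulLeftCLM_apply_apply (by fun_prop)]
    simp [basisVec, EuclideanSpace.inner_single_right]
    ring
  simp only [h2, Pi.zero_apply]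
  have h3 := congrArg (fun z => -(2 * Real.pi * Complex.I) * (𝓕⁻ θ) η * z) (h η)
  simp only [mul_zero, Finset.mul_sum] at h3
  rw [← h3]
  refine Finset.sum_congr rfl fun i _ => ?_
  ring

lemma fderiv_ofRealCLM_comp {g : E3 → ℝ} (hg : Differentiable ℝ g) (x v : E3) :
    fderiv ℝ (Complex.ofRealCLM ∘ g) x v = ((fderiv ℝ g x v : ℝ) : ℂ) := by
  rw [fderiv_comp x (by fun_prop) (hg x)]
  simp

lemma memLp_coord {F : E3 → C3} {p : ENNReal} (hF : MemLp F p volume) (i : Fin 3) :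
    MemLp (fun x => F x i) p (volume : Measure E3) :=
  (EuclideanSpace.proj i : C3 →L[ℂ] ℂ).comp_memLp' hF

lemma integrable_mul_coord (u : Lp C3 2 (volume : Measure E3)) {g : E3 → ℂ}
    (hg : MemLp g 2 volume) (i : Fin 3) : Integrable fun x => g x * u x i := by
  exact hg.integrable_mul (memLp_coord (Lp.memLp u) i)

/-- Test functions in `IsDivFree` are real; real and imaginary parts are tested separately. -/
lemma IsDivFree.integral_complex_eq_zero {u : Lp C3 2 (volume : Measure E3)} (hu : IsDivFree u)
    {g : E3 → ℂ} (hg : ContDiff ℝ ∞ g) (hg' : HasCompactSupport g) :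
    ∫ x, ∑ i, fderiv ℝ g x (basisVec i) * u x i = 0 := by
  have hd : Differentiable ℝ g := hg.differentiable (by simp)
  have h1 := hu (fun x => (g x).re) (Complex.reCLM.contDiff.comp hg)
    (hg'.comp_left (g := Complex.re) rfl)
  have h2 := hu (fun x => (g x).im) (Complex.imCLM.contDiff.comp hg)
    (hg'.comp_left (g := Complex.im) rfl)
  have e1 : ∀ x v, fderiv ℝ (fun x => (g x).re) x v = (fderiv ℝ g x v).re := fun x v => by
    have := fderiv_comp x (Complex.reCLM.differentiableAt) (hd x)
    rw [ContinuousLinearMap.fderiv] at this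
    exact congrArg (fun T => T v) this
  have e2 : ∀ x v, fderiv ℝ (fun x => (g x).im) x v = (fderiv ℝ g x v).im := fun x v => by
    have := fderiv_comp x (Complex.imCLM.differentiableAt) (hd x)
    rw [ContinuousLinearMap.fderiv] at this
    exact congrArg (fun T => T v) this
  simp only [e1, e2] at h1 h2
  have hm : ∀ i, MemLp (fun x => fderiv ℝ g x (basisVec i)) 2 (volume : Measure E3) := fun i =>
    Continuous.memLp_of_hasCompactSupport
      ((hg.continuous_fderiv (by simp)).clm_apply continuous_const)
      (hg'.fderiv_apply ℝ (basisVec i))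
  have hr : ∀ i, Integrable fun x => ((fderiv ℝ g x (basisVec i)).re : ℂ) * u x i := fun i =>
    integrable_mul_coord u (g := fun x => ((fderiv ℝ g x (basisVec i)).re : ℂ))
      ((hm i).re.ofReal) i
  have hi : ∀ i, Integrable fun x => ((fderiv ℝ g x (basisVec i)).im : ℂ) * u x i := fun i =>
    integrable_mul_coord u (g := fun x => ((fderiv ℝ g x (basisVec i)).im : ℂ))
      ((hm i).im.ofReal) i
  have e : ∀ x, ∑ i, fderiv ℝ g x (basisVec i) * u x i =
      (∑ i, ((fderiv ℝ g x (basisVec i)).re : ℂ) * u x i) +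
        Complex.I * ∑ i, ((fderiv ℝ g x (basisVec i)).im : ℂ) * u x i := by
    intro x
    rw [Finset.mul_sum, ← Finset.sum_add_distrib]
    refine Finset.sum_congr rfl fun i _ => ?_
    conv_lhs => rw [← Complex.re_add_im (fderiv ℝ g x (basisVec i))]
    ring
  simp only [e]
  rw [integral_add (integrable_finsetSum _ fun i _ => hr i)
    ((integrable_finsetSum _ fun i _ => hi i).const_mul _), integral_const_mul, h1, h2]
  simp

/-- A smooth compactly supported function equal to one near the origin. -/
noncomputable def cutoff : ContDiffBump (0 : E3) := ⟨1, 2, by norm_num, by norm_num⟩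

lemma cutoff_smul_eventually (x : E3) :
    ∀ᶠ n : ℕ in Filter.atTop, cutoff (((n : ℝ) + 1)⁻¹ • x) = 1 := by
  obtain ⟨N, hN⟩ := exists_nat_gt ‖x‖
  filter_upwards [Filter.eventually_ge_atTop N] with n hn
  refine cutoff.one_of_mem_closedBall ?_
  have hn' : (N : ℝ) ≤ n := by exact_mod_cast hn
  have h0 : (0 : ℝ) < (n : ℝ) + 1 := by positivity
  rw [mem_closedBall_zero_iff, norm_smul, norm_inv, Real.norm_of_nonneg h0.le]
  change _ ≤ (1 : ℝ)
  rw [inv_mul_le_iff₀ h0]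
  linarith

/-- Weak divergence freedom can be tested against Schwartz functions. -/
lemma IsDivFree.integral_schwartz_eq_zero {u : Lp C3 2 (volume : Measure E3)} (hu : IsDivFree u)
    (f : 𝓢(E3, ℂ)) : ∫ x, ∑ i, (∂_{basisVec i} f) x * u x i = 0 := by
  obtain ⟨C, hC⟩ : ∃ C, ∀ x, ‖fderiv ℝ cutoff x‖ ≤ C :=
    ((cutoff.contDiff (n := 1)).continuous_fderiv (by simp)).bounded_above_of_compact_support
      (cutoff.hasCompactSupport.fderiv ℝ)
  have hC0 : 0 ≤ C := (norm_nonneg _).trans (hC 0)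
  -- Dilated cutoffs: `χ n` tends to `1` pointwise and its gradient is `O(1/(n+1))`. Testing with `χ
  -- n * f` and letting `n → ∞` removes the compact support by dominated convergence.
  set χ : ℕ → E3 → ℂ := fun n x => ((cutoff (((n : ℝ) + 1)⁻¹ • x) : ℝ) : ℂ) with hχ
  have hχs : ∀ n, ContDiff ℝ ∞ (χ n) := fun n =>
    Complex.ofRealCLM.contDiff.comp (cutoff.contDiff.comp (contDiff_const_smul _))
  have hχc : ∀ n, HasCompactSupport (χ n) := fun n => by
    have : HasCompactSupport fun x : E3 => cutoff (((n : ℝ) + 1)⁻¹ • x) :=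
      cutoff.hasCompactSupport.comp_smul (by positivity)
    exact this.comp_left (g := Complex.ofReal) rfl
  have hχd : ∀ n x v, ‖fderiv ℝ (χ n) x v‖ ≤ ((n : ℝ) + 1)⁻¹ * C * ‖v‖ := fun n x v => by
    have hcd : Differentiable ℝ cutoff := (cutoff.contDiff (n := 1)).differentiable (by simp)
    have h1 := fderiv_ofRealCLM_comp (g := fun x => cutoff (((n : ℝ) + 1)⁻¹ • x))
      (hcd.comp (by fun_prop : Differentiable ℝ fun x : E3 => ((n : ℝ) + 1)⁻¹ • x)) x v
    have h2 : fderiv ℝ (fun x : E3 => cutoff (((n : ℝ) + 1)⁻¹ • x)) x =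
        ((n : ℝ) + 1)⁻¹ • fderiv ℝ cutoff (((n : ℝ) + 1)⁻¹ • x) := fderiv_comp_smul _
    rw [h2] at h1
    change ‖fderiv ℝ (Complex.ofRealCLM ∘ fun x => cutoff (((n : ℝ) + 1)⁻¹ • x)) x v‖ ≤ _
    have h0 : (0 : ℝ) ≤ ((n : ℝ) + 1)⁻¹ := by positivity
    rw [h1, Complex.norm_real, _root_.smul_apply, norm_smul, Real.norm_of_nonneg h0, mul_assoc]
    gcongr
    exact (ContinuousLinearMap.le_opNorm _ _).trans (by gcongr; exact hC _)
  have hχ1 : ∀ n x, ‖χ n x‖ ≤ 1 := fun n x => by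
    rw [hχ, Complex.norm_real, Real.norm_of_nonneg cutoff.nonneg]
    exact cutoff.le_one
  have hprod : ∀ n x v, fderiv ℝ (fun x => χ n x * f x) x v =
      χ n x * (∂_{v} f) x + f x * fderiv ℝ (χ n) x v := fun n x v => by
    have h1 := fderiv_fun_mul (((hχs n).differentiable (by simp)) x) (f.differentiable x)
    rw [h1, SchwartzMap.lineDerivOp_apply_eq_fderiv]
    simp
  have hzero : ∀ n, ∫ x, ∑ i, (χ n x * (∂_{basisVec i} f) x +
      f x * fderiv ℝ (χ n) x (basisVec i)) * u x i = 0 := fun n => by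
    have := hu.integral_complex_eq_zero (g := fun x => χ n x * f x)
      ((hχs n).mul (f.smooth ⊤)) ((hχc n).mul_right)
    simpa only [hprod] using this
  have hdom : ∀ n x i, ‖(χ n x * (∂_{basisVec i} f) x +
      f x * fderiv ℝ (χ n) x (basisVec i)) * u x i‖ ≤
        ‖(∂_{basisVec i} f) x * u x i‖ + C * ‖f x * u x i‖ := fun n x i => by
    rw [add_mul]
    refine (norm_add_le _ _).trans (add_le_add ?_ ?_)
    · rw [mul_assoc, norm_mul]
      exact mul_le_of_le_one_left (norm_nonneg _) (hχ1 n x)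
    · rw [mul_right_comm, norm_mul _ (fderiv ℝ (χ n) x (basisVec i)), mul_comm]
      refine mul_le_mul_of_nonneg_right ((hχd n x _).trans ?_) (norm_nonneg _)
      have h1 : ((n : ℝ) + 1)⁻¹ ≤ 1 :=
        inv_le_one_of_one_le₀ (by linarith [Nat.cast_nonneg (α := ℝ) n])
      simp only [basisVec, PiLp.norm_single, norm_one, mul_one]
      exact mul_le_of_le_one_left hC0 h1
  have hlim := tendsto_integral_of_dominated_convergence
    (F := fun n x => ∑ i, (χ n x * (∂_{basisVec i} f) x +
      f x * fderiv ℝ (χ n) x (basisVec i)) * u x i)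
    (f := fun x => ∑ i, (∂_{basisVec i} f) x * u x i) (μ := (volume : Measure E3))
    (fun x => ∑ i : Fin 3, (‖(∂_{basisVec i} f) x * u x i‖ + C * ‖f x * u x i‖)) ?_ ?_ ?_ ?_
  · simp only [hzero] at hlim
    exact (tendsto_nhds_unique hlim tendsto_const_nhds)
  · intro n
    have hum : ∀ i, AEStronglyMeasurable (fun x => u x i) (volume : Measure E3) := fun i =>
      (memLp_coord (Lp.memLp u) i).1
    refine Finset.aestronglyMeasurable_fun_sum _ fun i _ => AEStronglyMeasurable.mul ?_ (hum i)
    refine Continuous.aestronglyMeasurable ?_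
    have := ((hχs n).continuous_fderiv (by simp)).clm_apply
      (continuous_const (y := basisVec i))
    have h2 := (hχs n).continuous
    have h3 := f.continuous
    have h4 := (∂_{basisVec i} f).continuous
    fun_prop
  · refine integrable_finsetSum _ fun i _ => ?_
    exact (integrable_mul_coord u ((∂_{basisVec i} f).memLp 2) i).norm.add
      ((integrable_mul_coord u (f.memLp 2) i).norm.const_mul C)
  · exact fun n => Filter.Eventually.of_forall fun x =>
      (norm_sum_le _ _).trans (Finset.sum_le_sum fun i _ => hdom n x i)
  · refine Filter.Eventually.of_forall fun x => tendsto_finsetSum _ fun i _ => ?_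
    refine Filter.Tendsto.mul_const _ ?_
    have h1 : Filter.Tendsto (fun n => χ n x) Filter.atTop (nhds 1) := by
      refine tendsto_const_nhds.congr' ?_
      filter_upwards [cutoff_smul_eventually x] with n hn
      simp [hχ, hn]
    have h2 : Filter.Tendsto (fun n => fderiv ℝ (χ n) x (basisVec i)) Filter.atTop (nhds 0) := by
      refine squeeze_zero_norm (fun n => hχd n x _) ?_
      have := tendsto_one_div_add_atTop_nhds_zero_nat (𝕜 := ℝ)
      simpa using (this.mul_const C).mul_const ‖basisVec i‖
    simpa using (h1.mul_const ((∂_{basisVec i} f) x)).add (h2.const_mul (f x))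

/-- The Fourier transform of a divergence-free field is orthogonal to the frequency. -/
lemma IsDivFree.sum_mul_fourier_eq_zero {u : Lp C3 2 (volume : Measure E3)} (hu : IsDivFree u) :
    ∀ᵐ η : E3, ∑ i, ((η i : ℝ) : ℂ) * (𝓕 u : Lp C3 2 (volume : Measure E3)) η i = 0 := by
  set U : Lp C3 2 (volume : Measure E3) := 𝓕 u with hU
  have hli : ∀ i, LocallyIntegrable (fun η => U η i) (volume : Measure E3) := fun i =>
    (memLp_coord (Lp.memLp U) i).locallyIntegrable (by norm_num)
  have hci : ∀ i : Fin 3, Continuous fun η : E3 => ((η i : ℝ) : ℂ) := fun i => by fun_prop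
  refine ae_eq_zero_of_integral_contDiff_smul_eq_zero ?_ fun g hg1 hg2 => ?_
  · exact locallyIntegrable_finsetSum _ fun i _ => (hli i).continuous_smul (hci i)
  set θ := testFun g hg1 hg2 with hθ
  have hterm : ∀ i, ∫ x, (∂_{basisVec i} (𝓕 θ)) x * u x i =
      ∫ η, -(2 * Real.pi * Complex.I) * (((η i : ℝ) : ℂ) * θ η) * U η i := by
    intro i
    -- Chosen so that `𝓕 ψ` is the `i`-th derivative of `𝓕 θ`; the duality defining the transform of
    -- `u` then replaces that derivative by multiplication by `-2πi η_i`.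
    set ψ : 𝓢(E3, ℂ) := -(2 * Real.pi * Complex.I) •
      SchwartzMap.smulLeftCLM ℂ (inner ℝ · (basisVec i)) θ with hψ
    have e : ∀ η, ψ η = -(2 * Real.pi * Complex.I) * (((η i : ℝ) : ℂ) * θ η) := by
      intro η
      rw [hψ, _root_.smul_apply, SchwartzMap.smulLeftCLM_apply_apply (by fun_prop)]
      simp [basisVec, EuclideanSpace.inner_single_right]
    have h3 := congrArg (fun T => T ψ) (Lp.fourier_toTemperedDistribution_eq u)
    simp only [TemperedDistribution.fourier_apply, Lp.toTemperedDistribution_apply] at h3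
    have h4 := congrArg (EuclideanSpace.proj i : C3 →L[ℂ] ℂ) h3
    rw [← ContinuousLinearMap.integral_comp_comm _ ?_,
      ← ContinuousLinearMap.integral_comp_comm _ ?_] at h4
    · rw [SchwartzMap.lineDerivOp_fourier_eq, ← hψ]
      simp only [← e]
      simpa using h4
    · exact memLp_one_iff_integrable.1 ((Lp.memLp U).smul (ψ.memLp 2))
    · exact memLp_one_iff_integrable.1 ((Lp.memLp u).smul ((𝓕 ψ).memLp 2))
  have h0 := hu.integral_schwartz_eq_zero (𝓕 θ)
  rw [integral_finsetSum _ fun i _ => integrable_mul_coord u ((∂_{basisVec i} (𝓕 θ)).memLp 2) i,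
    Finset.sum_congr rfl fun i _ => hterm i, ← integral_finsetSum] at h0
  · have e : ∀ η, ∑ i, -(2 * Real.pi * Complex.I) * (((η i : ℝ) : ℂ) * θ η) * U η i =
        -(2 * Real.pi * Complex.I) * (g η • ∑ i, ((η i : ℝ) : ℂ) * U η i) := by
      intro η
      rw [Complex.real_smul, Finset.mul_sum, Finset.mul_sum]
      refine Finset.sum_congr rfl fun i _ => ?_
      rw [hθ, testFun_apply]
      ring
    simp only [e] at h0
    rw [integral_const_mul] at h0
    refine (mul_eq_zero.1 h0).resolve_left ?_
    simp [Real.pi_ne_zero]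
  · intro i _
    refine integrable_mul_coord U (g := fun η => -(2 * Real.pi * Complex.I) *
      (((η i : ℝ) : ℂ) * θ η)) ?_ i
    refine Continuous.memLp_of_hasCompactSupport (by have := θ.continuous; fun_prop) ?_
    have h5 : HasCompactSupport θ := hg2.comp_left (g := Complex.ofReal) rfl
    exact (h5.mul_left (f := fun η : E3 => ((η i : ℝ) : ℂ))).mul_left

end DivFreeWavelet

namespace DivFreeWavelet

/-! ### Parseval for Fourier series on the unit cube -/

/-- The unit cube centred at the origin. -/
def unitCube : Set (Fin 3 → ℝ) := {x | ∀ i, x i ∈ Set.Ioc (-(1 / 2) : ℝ) (-(1 / 2) + 1)}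

lemma measurableSet_unitCube : MeasurableSet unitCube :=
  MeasurableSet.univ_pi' fun _ => measurableSet_Ioc

/-- A lattice point as a vector. -/
noncomputable def latticeVec (k : Fin 3 → ℤ) : E3 := WithLp.toLp 2 fun i => (k i : ℝ)

lemma mFourier_coe (k : Fin 3 → ℤ) (x : Fin 3 → ℝ) :
    UnitAddTorus.mFourier k (fun i => (x i : UnitAddCircle)) =
      Complex.exp (2 * Real.pi * Complex.I * ((∑ i, (k i : ℝ) * x i : ℝ) : ℂ)) := by
  simp only [UnitAddTorus.mFourier, ContinuousMap.coe_mk, fourier_coe_apply]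
  rw [← Complex.exp_sum]
  congr 1
  push_cast
  rw [Finset.mul_sum]
  refine Finset.sum_congr rfl fun i _ => ?_
  simp
  ring

/-- Parseval on the torus, transported to its half-open fundamental domain. -/
lemma hasSum_fourierCoeff_cube {f : (Fin 3 → ℝ) → ℂ} (hf : MemLp f 2 (volume.restrict unitCube)) :
    HasSum (fun k : Fin 3 → ℤ => ‖∫ x in unitCube,
      Complex.exp (2 * Real.pi * Complex.I * ((∑ i, (k i : ℝ) * x i : ℝ) : ℂ)) * f x‖ ^ 2)
      (∫ x in unitCube, ‖f x‖ ^ 2) := by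
  set a : Fin 3 → ℝ := fun _ => -(1 / 2) with ha
  set e := UnitAddTorus.measurableEquivPiIoc a with he
  set μT : Measure (UnitAddTorus (Fin 3)) := Measure.pi fun _ => AddCircle.haarAddCircle with hμT
  have hmp : MeasurePreserving e μT (Measure.comap Subtype.val volume) :=
    UnitAddTorus.measurePreserving_equivPiIoc a
  have hint : ∀ {G : Type} [NormedAddCommGroup G] [NormedSpace ℝ G] (F : (Fin 3 → ℝ) → G),
      ∫ t, F (e t) ∂μT = ∫ x in unitCube, F x := by
    intro G _ _ F
    have h1 := hmp.integral_comp e.measurableEmbedding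
      (fun y : {x : Fin 3 → ℝ // ∀ i, x i ∈ Set.Ioc (a i) (a i + 1)} => F y)
    rw [h1]
    exact integral_subtype_comap measurableSet_unitCube F
  have hmem : MemLp (fun t => f (e t)) 2 μT := by
    have h2 : MemLp (fun y : unitCube => f y) 2 (Measure.comap Subtype.val volume) := by
      have := (MeasurableEmbedding.subtype_coe measurableSet_unitCube).memLp_map_measure_iff
        (μ := Measure.comap Subtype.val (volume : Measure (Fin 3 → ℝ))) (g := f) (p := 2)
      rw [map_comap_subtype_coe measurableSet_unitCube] at this
      exact this.1 hf
    exact h2.comp_measurePreserving hmp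
  have key := UnitAddTorus.hasSum_sq_mFourierCoeff (hmem.toLp _)
  have hnorm : ∫ t, ‖hmem.toLp _ t‖ ^ 2 ∂μT = ∫ x in unitCube, ‖f x‖ ^ 2 := by
    rw [← hint fun x => ‖f x‖ ^ 2]
    refine integral_congr_ae ?_
    filter_upwards [hmem.coeFn_toLp] with t ht
    rw [ht]
  have hcoef : ∀ k : Fin 3 → ℤ, UnitAddTorus.mFourierCoeff (hmem.toLp _) k = ∫ x in unitCube,
      Complex.exp (2 * Real.pi * Complex.I * ((∑ i, ((-k) i : ℝ) * x i : ℝ) : ℂ)) * f x := by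
    intro k
    rw [← hint fun x => Complex.exp (2 * Real.pi * Complex.I *
      ((∑ i, ((-k) i : ℝ) * x i : ℝ) : ℂ)) * f x]
    refine integral_congr_ae ?_
    change _ =ᵐ[μT] _
    filter_upwards [hmem.coeFn_toLp] with t ht
    rw [ht, smul_eq_mul]
    congr 1
    have h3 := mFourier_coe (-k) (e t)
    have h4 : (fun i => (((e t : Fin 3 → ℝ) i : ℝ) : UnitAddCircle)) = t :=
      e.symm_apply_apply t
    rw [h4] at h3
    rw [h3]
  have key' : HasSum (fun k : Fin 3 → ℤ => ‖∫ x in unitCube,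
      Complex.exp (2 * Real.pi * Complex.I * ((∑ i, ((-k) i : ℝ) * x i : ℝ) : ℂ)) * f x‖ ^ 2)
      (∫ x in unitCube, ‖f x‖ ^ 2) := by
    rw [← hnorm]
    simp only [← hcoef]
    exact key
  -- Torus coefficients carry `e^{-2πi k·x}`; the sign is changed by reindexing `k ↦ -k`.
  have := (Equiv.neg (Fin 3 → ℤ)).hasSum_iff (f := fun k : Fin 3 → ℤ => ‖∫ x in unitCube,
      Complex.exp (2 * Real.pi * Complex.I * ((∑ i, (k i : ℝ) * x i : ℝ) : ℂ)) * f x‖ ^ 2)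
      (a := ∫ x in unitCube, ‖f x‖ ^ 2)
  rw [← this]
  convert! key' using 1

/-- Parseval's identity for functions supported in the ball of radius `1/2`. -/
lemma hasSum_fourierCoeff {f : E3 → ℂ} (hf : MemLp f 2 volume)
    (h0 : ∀ᵐ x : E3, 1 / 2 ≤ ‖x‖ → f x = 0) :
    HasSum (fun k : Fin 3 → ℤ => ‖∫ x : E3,
      Complex.exp (2 * Real.pi * Complex.I * ((inner ℝ (latticeVec k) x : ℝ) : ℂ)) * f x‖ ^ 2)
      (∫ x : E3, ‖f x‖ ^ 2) := by
  have hmp := PiLp.volume_preserving_toLp (Fin 3)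
  have hemb : MeasurableEmbedding (WithLp.toLp 2 : (Fin 3 → ℝ) → E3) :=
    (MeasurableEquiv.toLp 2 (Fin 3 → ℝ)).measurableEmbedding
  -- The open ball of radius `1/2` lies inside the cube, since each coordinate is bounded by the
  -- norm.
  have hz : ∀ᵐ x : Fin 3 → ℝ, x ∉ unitCube → f (WithLp.toLp 2 x) = 0 := by
    filter_upwards [hmp.quasiMeasurePreserving.ae h0] with x hx hxc
    refine hx ?_
    by_contra! hlt
    refine hxc fun i => ?_
    have := (PiLp.norm_apply_le (WithLp.toLp 2 x : E3) i).trans_lt hlt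
    rw [Real.norm_eq_abs, abs_lt] at this
    simp only [Set.mem_Ioc] at *
    constructor <;> linarith
  have h1 := hasSum_fourierCoeff_cube (f := fun x => f (WithLp.toLp 2 x))
    ((hf.comp_measurePreserving hmp).restrict _)
  have h2 : ∀ (k : Fin 3 → ℤ), ∫ x in unitCube,
      Complex.exp (2 * Real.pi * Complex.I * ((∑ i, (k i : ℝ) * x i : ℝ) : ℂ)) *
        f (WithLp.toLp 2 x) = ∫ x : E3, Complex.exp (2 * Real.pi * Complex.I *
          ((inner ℝ (latticeVec k) x : ℝ) : ℂ)) * f x := by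
    intro k
    rw [← hmp.integral_comp hemb, setIntegral_eq_integral_of_ae_compl_eq_zero]
    · congr 1
      ext x
      congr 5
      simp [latticeVec, mul_comm]
    · filter_upwards [hz] with x hx hxc
      rw [hx hxc, mul_zero]
  have h3 : ∫ x in unitCube, ‖f (WithLp.toLp 2 x)‖ ^ 2 = ∫ x : E3, ‖f x‖ ^ 2 := by
    rw [← hmp.integral_comp hemb, setIntegral_eq_integral_of_ae_compl_eq_zero]
    filter_upwards [hz] with x hx hxc
    simp [hx hxc]
  simp only [h2, h3] at h1
  exact h1

end DivFreeWavelet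

namespace DivFreeWavelet

open scoped FourierTransform

/-! ### The Hedgehog frame and the mother wavelets -/

lemma memLp_of_bound_of_support {F : E3 → C3} (hm : Measurable F) {C r : ℝ}
    (hC : ∀ x, ‖F x‖ ≤ C) (hr : ∀ x, r < ‖x‖ → F x = 0) (p : ENNReal) :
    MemLp F p (volume : Measure E3) := by
  have h1 : MemLp ((Metric.closedBall (0 : E3) r).indicator fun _ => C) p volume :=
    memLp_indicator_const p Metric.isClosed_closedBall.measurableSet C
      (Or.inr measure_closedBall_lt_top.ne)
  refine h1.mono' hm.aestronglyMeasurable (Filter.Eventually.of_forall fun x => ?_)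
  by_cases hx : ‖x‖ ≤ r
  · rw [Set.indicator_of_mem (by simpa using hx)]
    exact hC x
  · rw [Set.indicator_of_notMem (by simpa using hx), hr x (not_le.1 hx), norm_zero]

lemma measurable_sphHarm (l : ℕ) (m : ℤ) : Measurable (sphHarm l m) := by
  have h1 : Measurable fun v : E3 => assocLegendre l m (v 2) := by
    unfold assocLegendre
    refine Continuous.measurable ?_
    fun_prop
  have h2 : Measurable fun v : E3 => Complex.arg ((v 0 : ℂ) + Complex.I * (v 1 : ℂ)) :=
    Complex.measurable_arg.comp (by fun_prop)
  unfold sphHarm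
  fun_prop

lemma measurable_angularWindow (L : ℕ) (κ : ℕ → ℤ → ℂ) : Measurable (angularWindow L κ) := by
  have := measurable_sphHarm
  unfold angularWindow
  fun_prop

lemma measurable_normalize : Measurable fun ξ : E3 => ‖ξ‖⁻¹ • ξ := by fun_prop

lemma measurable_hedgehog (a : Fin 3) : Measurable (hedgehog a) := by
  refine Continuous.measurable ?_
  unfold hedgehog
  refine (PiLp.continuous_toLp 2 _).comp (continuous_pi fun i => Complex.continuous_ofReal.comp ?_)
  fin_cases a <;> fin_cases i <;> simp [crossProduct] <;> fun_prop

lemma norm_hedgehog_le (a : Fin 3) (v : E3) : ‖hedgehog a v‖ ≤ ‖v‖ := by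
  rw [← sq_le_sq₀ (norm_nonneg _) (norm_nonneg _), EuclideanSpace.norm_sq_eq,
    EuclideanSpace.norm_sq_eq]
  simp only [hedgehog, Fin.sum_univ_three, Complex.norm_real, Real.norm_eq_abs, sq_abs]
  fin_cases a <;> simp [crossProduct] <;> nlinarith [sq_nonneg (v 0), sq_nonneg (v 1),
    sq_nonneg (v 2)]

lemma sum_mul_hedgehog (a : Fin 3) (v : E3) : ∑ i, ((v i : ℝ) : ℂ) * hedgehog a v i = 0 := by
  simp only [hedgehog, Fin.sum_univ_three]
  fin_cases a <;> simp [crossProduct] <;> ring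

lemma inner_hedgehog (a : Fin 3) (ν : E3) (v : C3) :
    inner ℂ (hedgehog a ν) v =
      ∑ i, ((crossProduct (Pi.single a (1 : ℝ)) ν.ofLp i : ℝ) : ℂ) * v i := by
  simp [hedgehog, PiLp.inner_apply, mul_comm]

/-- The Hedgehog frame is a Parseval frame of the tangent space of the sphere. -/
lemma sum_norm_sq_inner_hedgehog {ν : E3} (hν : ‖ν‖ = 1) (v : C3) :
    ∑ a, ‖inner ℂ (hedgehog a ν) v‖ ^ 2 =
      ‖v‖ ^ 2 - ‖∑ i, ((ν i : ℝ) : ℂ) * v i‖ ^ 2 := by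
  have h1 : ν 0 ^ 2 + ν 1 ^ 2 + ν 2 ^ 2 = 1 := by
    have : ‖ν‖ ^ 2 = 1 := by simp [hν]
    rw [EuclideanSpace.norm_sq_eq] at this
    simpa [Fin.sum_univ_three] using this
  simp only [inner_hedgehog, EuclideanSpace.norm_sq_eq, Fin.sum_univ_three, ← Complex.normSq_eq_norm_sq,
    Complex.normSq_apply]
  simp [crossProduct]
  -- Since `(e_a × ν) · v = e_a · (ν × v)`, the left side is `|ν × v|²`, and Lagrange's identity
  -- with `|ν| = 1` concludes.
  linear_combination ((v 0).re ^ 2 + (v 1).re ^ 2 + (v 2).re ^ 2 + (v 0).im ^ 2 + (v 1).im ^ 2 +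
    (v 2).im ^ 2) * h1

lemma norm_normalize {ξ : E3} (hξ : ξ ≠ 0) : ‖‖ξ‖⁻¹ • ξ‖ = 1 := norm_smul_inv_norm hξ

lemma normalize_smul {c : ℝ} (hc : 0 < c) (ξ : E3) : ‖c • ξ‖⁻¹ • c • ξ = ‖ξ‖⁻¹ • ξ := by
  rw [norm_smul, Real.norm_of_nonneg hc.le, smul_smul, mul_inv]
  congr 1
  field_simp

/-- The term `j = 0` of a nonnegative series with sum `1`. This is the source of all boundedness of
the wavelets. -/
lemma norm_le_one_of_calderon {h : ℝ → ℂ}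
    (h_calderon : ∀ ξ : E3, ξ ≠ 0 → HasSum (fun j : ℤ => ‖h ((2 : ℝ) ^ (-j) * ‖ξ‖)‖ ^ 2) 1)
    {r : ℝ} (hr : 0 < r) : ‖h r‖ ≤ 1 := by
  have h1 := h_calderon (EuclideanSpace.single 0 r) (by simpa using hr.ne')
  have h2 := le_hasSum h1 0 fun j _ => by positivity
  rw [PiLp.norm_single, Real.norm_of_nonneg hr.le] at h2
  simp only [neg_zero, zpow_zero, one_mul] at h2
  exact (sq_le_one_iff₀ (norm_nonneg _)).1 h2

section wavelet

variable (h : ℝ → ℂ) (L : ℕ) (κ : ℕ → ℤ → ℂ) (R : Rot3) (a : Fin 3)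

lemma measurable_waveletHat (h_meas : Measurable h) : Measurable (waveletHat h L κ R a) := by
  have h1 := measurable_normalize
  have h2 : Measurable (rotate R⁻¹) := (rotateIsometry R⁻¹).continuous.measurable
  have h3 := (measurable_angularWindow L κ).comp (h2.comp h1)
  have h4 := (measurable_hedgehog a).comp h1
  have h5 := h_meas.comp (measurable_norm (α := E3))
  exact ((h3.const_mul (-Complex.I)).mul h5).smul h4

lemma waveletHat_eq_zero (h_band : ∀ r : ℝ, Real.pi < r → h r = 0) {ξ : E3}
    (hξ : Real.pi < ‖ξ‖) : waveletHat h L κ R a ξ = 0 := by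
  simp [waveletHat, h_band _ hξ]

lemma exists_norm_waveletHat_le (h1 : ∀ r : ℝ, 0 < r → ‖h r‖ ≤ 1) :
    ∃ C, ∀ ξ, ‖waveletHat h L κ R a ξ‖ ≤ C := by
  refine ⟨‖window L κ‖, fun ξ => ?_⟩
  -- At the origin the normalized vector is `0` by convention and the tangent field vanishes there,
  -- so no bound on `h 0` is needed.
  by_cases hξ : ξ = 0
  · subst hξ
    have : hedgehog a 0 = 0 := by
      rw [← norm_le_zero_iff]
      simpa using norm_hedgehog_le a 0
    simp [waveletHat, this]
  · have hn := norm_normalize hξ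
    have h2 : ‖angularWindow L κ (rotate R⁻¹ (‖ξ‖⁻¹ • ξ))‖ ≤ ‖window L κ‖ := by
      have hv : rotate R⁻¹ (‖ξ‖⁻¹ • ξ) ∈ S2 := by simp [norm_rotate, hn]
      rw [angularWindow_eq_window L κ ⟨_, hv⟩]
      exact (window L κ).norm_coe_le_norm _
    have h3 := norm_hedgehog_le a (‖ξ‖⁻¹ • ξ)
    rw [hn] at h3
    rw [waveletHat, norm_smul, norm_mul, norm_mul, norm_neg, Complex.norm_I, one_mul]
    have h4 := h1 ‖ξ‖ (norm_pos_iff.2 hξ)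
    calc _ ≤ ‖window L κ‖ * 1 * 1 := by gcongr
      _ = _ := by ring

lemma sum_mul_waveletHat (ξ : E3) : ∑ i, ((ξ i : ℝ) : ℂ) * waveletHat h L κ R a ξ i = 0 := by
  by_cases hξ : ξ = 0
  · simp [hξ]
  have h1 := sum_mul_hedgehog a (‖ξ‖⁻¹ • ξ)
  have h2 := congrArg (fun z => ((‖ξ‖ : ℝ) : ℂ) *
    (-Complex.I * angularWindow L κ (rotate R⁻¹ (‖ξ‖⁻¹ • ξ)) * h ‖ξ‖) * z) h1
  simp only [mul_zero, Finset.mul_sum] at h2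
  rw [← h2]
  refine Finset.sum_congr rfl fun i _ => ?_
  have h3 : ((‖ξ‖ : ℝ) : ℂ) ≠ 0 := by simpa using hξ
  simp only [waveletHat, PiLp.smul_apply, smul_eq_mul]
  push_cast
  field_simp

/-- A positive dilation changes only the radial factor, which decouples the sum over scales from
those over orientations and axes. -/
lemma norm_sq_inner_waveletHat {c : ℝ} (hc : 0 < c) (η : E3) (v : C3) :
    ‖inner ℂ (waveletHat h L κ R a (c • η)) v‖ ^ 2 =
      ‖h (c * ‖η‖)‖ ^ 2 * ‖angularWindow L κ (rotate R⁻¹ (‖η‖⁻¹ • η))‖ ^ 2 *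
        ‖inner ℂ (hedgehog a (‖η‖⁻¹ • η)) v‖ ^ 2 := by
  rw [waveletHat, normalize_smul hc, inner_smul_left, norm_mul, RCLike.norm_conj, norm_mul,
    norm_mul, norm_neg, Complex.norm_I, norm_smul, Real.norm_of_nonneg hc.le]
  ring

end wavelet

/-! ### Frame functions in frequency -/

section frame

variable (h : ℝ → ℂ) (L : ℤ → ℕ) (κ : ℤ → ℕ → ℤ → ℂ) (M : ℤ → ℕ)
  (R : (j : ℤ) → Fin (M j) → Rot3)

/-- The frequency scaling factor at level `j`. -/
noncomputable def freqScale (j : ℤ) : ℝ := 2 * Real.pi * (2 : ℝ) ^ (-j)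

lemma freqScale_pos (j : ℤ) : 0 < freqScale j := by unfold freqScale; positivity

/-- The Fourier transform of a frame function. -/
noncomputable def frameHat (s : FrameIndex M) (η : E3) : C3 :=
  ((((2 : ℝ) ^ (-(3 * (s.2.1 : ℝ) / 2)) : ℝ) : ℂ) * Complex.exp (-(2 * Real.pi * Complex.I *
    ((inner ℝ (latticeVec s.2.2.1) ((2 : ℝ) ^ (-s.2.1) • η) : ℝ) : ℂ)))) •
      waveletHat h (L s.2.1) (κ s.2.1) (R s.2.1 s.2.2.2) s.1 (freqScale s.2.1 • η)

lemma two_rpow_neg_mul (j : ℤ) :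
    ((2 : ℝ) ^ (3 * (j : ℝ) / 2)) * ((2 : ℝ) ^ (-j)) ^ 3 = (2 : ℝ) ^ (-(3 * (j : ℝ) / 2)) := by
  rw [← Real.rpow_intCast, ← Real.rpow_natCast, ← Real.rpow_mul (by norm_num),
    ← Real.rpow_add (by norm_num)]
  congr 1
  push_cast
  ring

/-- The substitution `ξ = c η` with `c = 2π 2^{-j}` performs the dilation and passes from the
unitary convention to the kernel `e^{2πi⟨η, x⟩}` of `𝓕⁻`; the translation by `k` becomes a phase. -/
lemma frameFun_eq_fourierInv (s : FrameIndex M) :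
    frameFun h L κ M R s = 𝓕⁻ (frameHat h L κ M R s) := by
  ext1 x
  set c := freqScale s.2.1 with hc
  have hc0 : 0 < c := freqScale_pos _
  set W := waveletHat h (L s.2.1) (κ s.2.1) (R s.2.1 s.2.2.2) s.1 with hW
  set y : E3 := (2 : ℝ) ^ s.2.1 • x - latticeVec s.2.2.1 with hy
  have h1 := Measure.integral_comp_smul (volume : Measure E3)
    (fun ξ => Complex.exp (Complex.I * ((inner ℝ ξ y : ℝ) : ℂ)) • W ξ) c
  have h2 : ∫ ξ : E3, Complex.exp (Complex.I * ((inner ℝ ξ y : ℝ) : ℂ)) • W ξ =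
      ((c ^ 3 : ℝ) : ℂ) • ∫ η : E3, Complex.exp (Complex.I * ((inner ℝ (c • η) y : ℝ) : ℂ)) •
        W (c • η) := by
    rw [h1, finrank_euclideanSpace, Fintype.card_fin, abs_of_pos (by positivity), Complex.coe_smul,
      smul_smul, mul_inv_cancel₀ (by positivity), one_smul]
  have h3 : frameFun h L κ M R s x =
      (((2 : ℝ) ^ (3 * (s.2.1 : ℝ) / 2) / (2 * Real.pi) ^ (3 / 2 : ℝ) : ℝ) : ℂ) •
        (((2 * Real.pi) ^ (-(3 / 2) : ℝ) : ℝ) : ℂ) •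
          ∫ ξ : E3, Complex.exp (Complex.I * ((inner ℝ ξ y : ℝ) : ℂ)) • W ξ := rfl
  -- The two factors `(2π)^{-3/2}` cancel the `(2π)³` in the Jacobian `c³`, leaving `2^{3j/2}
  -- 2^{-3j}`.
  have hconst : (2 : ℝ) ^ (3 * (s.2.1 : ℝ) / 2) / (2 * Real.pi) ^ (3 / 2 : ℝ) *
      (2 * Real.pi) ^ (-(3 / 2) : ℝ) * c ^ 3 = (2 : ℝ) ^ (-(3 * (s.2.1 : ℝ) / 2)) := by
    have hp : 0 < 2 * Real.pi := by positivity
    rw [← two_rpow_neg_mul, hc, freqScale, Real.rpow_neg hp.le]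
    have h4 : ((2 * Real.pi) ^ (3 / 2 : ℝ)) * ((2 * Real.pi) ^ (3 / 2 : ℝ)) =
        (2 * Real.pi) ^ 3 := by
      rw [← Real.rpow_add hp, ← Real.rpow_natCast]
      norm_num
    have h5 : (2 * Real.pi) ^ (3 / 2 : ℝ) ≠ 0 := (Real.rpow_pos_of_pos hp _).ne'
    rw [mul_pow (2 * Real.pi), ← h4]
    field_simp
  rw [h3, h2, smul_smul, smul_smul, ← Complex.ofReal_mul, ← Complex.ofReal_mul, hconst,
    Real.fourierInv_eq', ← integral_smul]
  congr 1
  ext1 η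
  have hin : (inner ℝ (c • η) y : ℝ) = 2 * Real.pi * inner ℝ η x -
      2 * Real.pi * inner ℝ (latticeVec s.2.2.1) ((2 : ℝ) ^ (-s.2.1) • η) := by
    rw [hy, inner_sub_right, real_inner_smul_left, real_inner_smul_right, real_inner_smul_left,
      real_inner_smul_right, real_inner_comm (latticeVec s.2.2.1) η, hc, freqScale, zpow_neg]
    field_simp
  rw [frameHat, ← hW, ← hc, smul_smul, smul_smul, hin]
  congr 1
  rw [mul_left_comm, ← Complex.exp_add]
  congr 2
  push_cast
  ring

lemma measurable_frameHat (h_meas : Measurable h) (s : FrameIndex M) : Measurable (frameHat h L κ M R s) := by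
  have h2 := (measurable_waveletHat h (L s.2.1) (κ s.2.1) (R s.2.1 s.2.2.2) s.1 h_meas).comp
    (measurable_const_smul (freqScale s.2.1) (α := E3))
  have h3 : Measurable fun η : E3 => (((2 : ℝ) ^ (-(3 * (s.2.1 : ℝ) / 2)) : ℝ) : ℂ) *
      Complex.exp (-(2 * Real.pi * Complex.I *
        ((inner ℝ (latticeVec s.2.2.1) ((2 : ℝ) ^ (-s.2.1) • η) : ℝ) : ℂ))) :=
    Continuous.measurable (by fun_prop)
  exact h3.smul h2

lemma memLp_frameHat (h_meas : Measurable h) (h_band : ∀ r : ℝ, Real.pi < r → h r = 0)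
    (h1 : ∀ r : ℝ, 0 < r → ‖h r‖ ≤ 1) (s : FrameIndex M) (p : ENNReal) :
    MemLp (frameHat h L κ M R s) p (volume : Measure E3) := by
  obtain ⟨C, hC⟩ := exists_norm_waveletHat_le h (L s.2.1) (κ s.2.1) (R s.2.1 s.2.2.2) s.1 h1
  refine memLp_of_bound_of_support (measurable_frameHat h L κ M R h_meas s)
    (C := (2 : ℝ) ^ (-(3 * (s.2.1 : ℝ) / 2)) * C) (r := Real.pi / freqScale s.2.1) ?_ ?_ p
  · intro η
    rw [frameHat, norm_smul, norm_mul, Complex.norm_real, Real.norm_of_nonneg (by positivity),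
      Complex.norm_exp]
    simp only [Complex.neg_re, Complex.mul_re, Complex.ofReal_im, Complex.I_re, Complex.I_im]
    simp
    exact mul_le_mul_of_nonneg_left (hC _) (by positivity)
  · intro η hη
    rw [div_lt_iff₀ (freqScale_pos _)] at hη
    rw [frameHat, waveletHat_eq_zero _ _ _ _ _ h_band, smul_zero]
    rwa [norm_smul, Real.norm_of_nonneg (freqScale_pos _).le, mul_comm]

lemma sum_mul_frameHat (s : FrameIndex M) (η : E3) :
    ∑ i, ((η i : ℝ) : ℂ) * frameHat h L κ M R s η i = 0 := by
  have h2 := sum_mul_waveletHat h (L s.2.1) (κ s.2.1) (R s.2.1 s.2.2.2) s.1 (freqScale s.2.1 • η)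
  have hc : ((freqScale s.2.1 : ℝ) : ℂ) ≠ 0 := by exact_mod_cast (freqScale_pos _).ne'
  have h3 : ((freqScale s.2.1 : ℝ) : ℂ) * ∑ i, ((η i : ℝ) : ℂ) * frameHat h L κ M R s η i = 0 := by
    rw [frameHat]
    set d : ℂ := (((2 : ℝ) ^ (-(3 * (s.2.1 : ℝ) / 2)) : ℝ) : ℂ) *
      Complex.exp (-(2 * Real.pi * Complex.I *
        ((inner ℝ (latticeVec s.2.2.1) ((2 : ℝ) ^ (-s.2.1) • η) : ℝ) : ℂ)))
    rw [← mul_zero d, ← h2, Finset.mul_sum, Finset.mul_sum]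
    refine Finset.sum_congr rfl fun i _ => ?_
    simp only [PiLp.smul_apply, smul_eq_mul]
    push_cast
    ring
  exact (mul_eq_zero.1 h3).resolve_left hc

lemma isDivFree_frameFun (s : FrameIndex M) (hint : Integrable (frameHat h L κ M R s)) :
    IsDivFree (frameFun h L κ M R s) := by
  rw [frameFun_eq_fourierInv]
  exact isDivFree_fourierInv hint (sum_mul_frameHat h L κ M R s)

end frame

/-! ### Summation over lattice translates at a fixed scale -/

section frame

variable (h : ℝ → ℂ) (L : ℤ → ℕ) (κ : ℤ → ℕ → ℤ → ℂ) (M : ℤ → ℕ)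
  (R : (j : ℤ) → Fin (M j) → Rot3)

/-- The pairing of a frequency-domain field with a scaled mother wavelet. -/
noncomputable def pairing (U : E3 → C3) (a : Fin 3) (j : ℤ) (t : Fin (M j)) (η : E3) : ℂ :=
  inner ℂ (waveletHat h (L j) (κ j) (R j t) a (freqScale j • η)) (U η)

lemma measurable_pairing (h_meas : Measurable h) {U : E3 → C3} (hU : Measurable U) (a : Fin 3)
    (j : ℤ) (t : Fin (M j)) : Measurable (pairing h L κ M R U a j t) := by
  have h2 := (measurable_waveletHat h (L j) (κ j) (R j t) a h_meas).comp
    (measurable_const_smul (freqScale j) (α := E3))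
  exact h2.inner hU

lemma memLp_pairing (h_meas : Measurable h) (h1 : ∀ r : ℝ, 0 < r → ‖h r‖ ≤ 1) {U : E3 → C3}
    (hU : Measurable U) (hU2 : MemLp U 2 volume) (a : Fin 3) (j : ℤ) (t : Fin (M j)) :
    MemLp (pairing h L κ M R U a j t) 2 volume := by
  obtain ⟨C, hC⟩ := exists_norm_waveletHat_le h (L j) (κ j) (R j t) a h1
  refine hU2.of_le_mul (c := C)
    (measurable_pairing h L κ M R h_meas hU a j t).aestronglyMeasurable ?_
  refine Filter.Eventually.of_forall fun η => (norm_inner_le_norm _ _).trans ?_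
  exact mul_le_mul_of_nonneg_right (hC _) (norm_nonneg _)

/-- After `η = 2^j ζ` the coefficients are the Fourier coefficients of `Ψ`, which the band limit
confines to one period cell. -/
lemma hasSum_translates (h_meas : Measurable h) (h_band : ∀ r : ℝ, Real.pi < r → h r = 0)
    (h1 : ∀ r : ℝ, 0 < r → ‖h r‖ ≤ 1) {U : E3 → C3}
    (hU : Measurable U) (hU2 : MemLp U 2 volume) (a : Fin 3) (j : ℤ) (t : Fin (M j)) :
    HasSum (fun k : Fin 3 → ℤ =>
        ‖∫ η, inner ℂ (frameHat h L κ M R (a, ⟨j, k, t⟩) η) (U η)‖ ^ 2)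
      (∫ η, ‖pairing h L κ M R U a j t η‖ ^ 2) := by
  set Φ := pairing h L κ M R U a j t with hΦ
  have hΦm : Measurable Φ := measurable_pairing h L κ M R h_meas hU a j t
  have hΦ2 : MemLp Φ 2 volume := memLp_pairing h L κ M R h_meas h1 hU hU2 a j t
  set c : ℝ := (2 : ℝ) ^ j with hc
  have hc0 : 0 < c := by positivity
  have hscale : ∀ (G : Type) [NormedAddCommGroup G] [NormedSpace ℝ G] (F : E3 → G),
      ∫ η, F η = c ^ 3 • ∫ ζ : E3, F (c • ζ) := by
    intro G _ _ F
    rw [Measure.integral_comp_smul, finrank_euclideanSpace, Fintype.card_fin,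
      abs_of_pos (by positivity), smul_smul, mul_inv_cancel₀ (by positivity), one_smul]
  set b : ℝ := (2 : ℝ) ^ (3 * (j : ℝ) / 2) with hb
  have hb0 : 0 < b := by positivity
  have hbc : b ^ 2 = c ^ 3 := by
    rw [hb, hc, ← Real.rpow_intCast, ← Real.rpow_natCast, ← Real.rpow_natCast,
      ← Real.rpow_mul (by norm_num), ← Real.rpow_mul (by norm_num)]
    congr 1
    push_cast
    ring
  -- The factor `b = 2^{3j/2}` makes the dilation an `L²` isometry.
  set Ψ : E3 → ℂ := fun ζ => (b : ℂ) * Φ (c • ζ) with hΨ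
  have hΨm : Measurable Ψ := (hΦm.comp (measurable_const_smul c)).const_mul _
  have hΨ2 : MemLp Ψ 2 volume := by
    have h2 := (memLp_two_iff_integrable_sq_norm hΦm.aestronglyMeasurable).1 hΦ2
    rw [memLp_two_iff_integrable_sq_norm hΨm.aestronglyMeasurable]
    have h3 := (h2.comp_smul hc0.ne').const_mul (b ^ 2)
    refine h3.congr (Filter.Eventually.of_forall fun ζ => ?_)
    simp only [hΨ, norm_mul, Complex.norm_real, Real.norm_of_nonneg hb0.le, mul_pow]
  -- Since `freqScale j * 2^j = 2π`, the bound `π` becomes `1/2`. The sphere of radius `1/2` is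
  -- discarded as a null set, because `h π` may be nonzero.
  have hΨ0 : ∀ᵐ ζ : E3, 1 / 2 ≤ ‖ζ‖ → Ψ ζ = 0 := by
    have hs : (volume : Measure E3) (Metric.sphere 0 (1 / 2)) = 0 :=
      Measure.addHaar_sphere _ _ _
    filter_upwards [compl_mem_ae_iff.2 hs] with ζ hζ hle
    have hlt : 1 / 2 < ‖ζ‖ := lt_of_le_of_ne hle fun h' => hζ (by simpa using h'.symm)
    have hpi : Real.pi < ‖freqScale j • c • ζ‖ := by
      rw [norm_smul, norm_smul, Real.norm_of_nonneg (freqScale_pos j).le,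
        Real.norm_of_nonneg hc0.le, freqScale, hc, zpow_neg]
      have : (2 : ℝ) ^ j ≠ 0 := by positivity
      have e : 2 * Real.pi * ((2 : ℝ) ^ j)⁻¹ * ((2 : ℝ) ^ j * ‖ζ‖) = Real.pi * (2 * ‖ζ‖) := by
        field_simp
      rw [e]
      nlinarith [Real.pi_pos]
    simp [hΨ, hΦ, pairing, waveletHat_eq_zero _ _ _ _ _ h_band hpi]
  have key := hasSum_fourierCoeff hΨ2 hΨ0
  have hnorm : ∫ ζ, ‖Ψ ζ‖ ^ 2 = ∫ η, ‖Φ η‖ ^ 2 := by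
    rw [hscale ℝ fun η => ‖Φ η‖ ^ 2, smul_eq_mul, ← integral_const_mul, ← hbc]
    congr 1
    ext ζ
    simp only [hΨ, norm_mul, Complex.norm_real, Real.norm_of_nonneg hb0.le, mul_pow]
  have hcoef : ∀ k, ∫ η, inner ℂ (frameHat h L κ M R (a, ⟨j, k, t⟩) η) (U η) =
      ∫ ζ, Complex.exp (2 * Real.pi * Complex.I * ((inner ℝ (latticeVec k) ζ : ℝ) : ℂ)) * Ψ ζ := by
    intro k
    rw [hscale ℂ, ← Complex.coe_smul, ← integral_smul]
    congr 1
    ext ζ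
    have hin : (2 : ℝ) ^ (-j) • c • ζ = ζ := by
      rw [smul_smul, hc, ← zpow_add₀ (by norm_num)]
      simp
    have hb2 : (2 : ℝ) ^ (-(3 * (j : ℝ) / 2)) = b⁻¹ := Real.rpow_neg (by norm_num) _
    have hb3 : c ^ 3 * b⁻¹ = b := by rw [← hbc]; field_simp
    simp only [frameHat, hin, hb2]
    rw [inner_smul_left, hΨ, smul_eq_mul]
    simp only [map_mul, Complex.conj_ofReal, ← Complex.exp_conj, map_neg, map_ofNat,
      Complex.conj_I]
    have e : -(2 * (Real.pi : ℂ) * -Complex.I * ((inner ℝ (latticeVec k) ζ : ℝ) : ℂ)) =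
        2 * Real.pi * Complex.I * ((inner ℝ (latticeVec k) ζ : ℝ) : ℂ) := by ring
    have hb4 : ((c ^ 3 : ℝ) : ℂ) * ((b⁻¹ : ℝ) : ℂ) = (b : ℂ) := by
      rw [← Complex.ofReal_mul, hb3]
    rw [e, ← mul_assoc, ← mul_assoc, hb4, mul_comm (b : ℂ), mul_assoc]
    rfl
  simp only [hcoef, ← hnorm]
  exact key

end frame

/-! ### From Parseval to reconstruction -/

/-- Bessel's inequality for all vectors and Parseval's identity at `u` give the
reconstruction of `u`. -/
lemma hasSum_inner_smul {ι H : Type*} [NormedAddCommGroup H] [InnerProductSpace ℂ H] (ψ : ι → H)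
    (hB : ∀ (v : H) (F : Finset ι), ∑ s ∈ F, ‖inner ℂ (ψ s) v‖ ^ 2 ≤ ‖v‖ ^ 2) (u : H)
    (hu : HasSum (fun s => ‖inner ℂ (ψ s) u‖ ^ 2) (‖u‖ ^ 2)) :
    HasSum (fun s => inner ℂ (ψ s) u • ψ s) u := by
  -- Cauchy–Schwarz and Bessel at the partial sum `P` give `‖P‖⁴ ≤ (∑ |c_s|²) ‖P‖²`. Having Bessel
  -- for all vectors avoids checking that `P` lies in the subspace where Parseval holds.
  have hle : ∀ F : Finset ι, ‖∑ s ∈ F, inner ℂ (ψ s) u • ψ s‖ ^ 2 ≤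
      ∑ s ∈ F, ‖inner ℂ (ψ s) u‖ ^ 2 := by
    intro F
    set P := ∑ s ∈ F, inner ℂ (ψ s) u • ψ s with hP
    have h1 : ‖P‖ ^ 2 ≤ ∑ s ∈ F, ‖inner ℂ (ψ s) u‖ * ‖inner ℂ (ψ s) P‖ := by
      have h2 : inner ℂ P P = ∑ s ∈ F, conj (inner ℂ (ψ s) u) * inner ℂ (ψ s) P := by
        conv_lhs => rw [hP]
        rw [sum_inner]
        simp only [inner_smul_left]
        rw [← hP]
      have h3 : ‖P‖ ^ 2 = ‖inner ℂ P P‖ := by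
        rw [inner_self_eq_norm_sq_to_K]
        simp
      rw [h3, h2]
      refine (norm_sum_le _ _).trans (le_of_eq ?_)
      simp only [norm_mul, RCLike.norm_conj]
    have h4 := Finset.sum_mul_sq_le_sq_mul_sq F (fun s => ‖inner ℂ (ψ s) u‖)
      (fun s => ‖inner ℂ (ψ s) P‖)
    have h5 := hB P F
    have h6 : 0 ≤ ∑ s ∈ F, ‖inner ℂ (ψ s) u‖ ^ 2 := Finset.sum_nonneg fun _ _ => by positivity
    rcases (sq_nonneg ‖P‖).eq_or_lt with h0 | h0
    · rw [← h0]; exact h6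
    · have h7 : (‖P‖ ^ 2) ^ 2 ≤ (∑ s ∈ F, ‖inner ℂ (ψ s) u‖ ^ 2) * ‖P‖ ^ 2 :=
        (pow_le_pow_left₀ h0.le h1 2).trans (h4.trans (mul_le_mul_of_nonneg_left h5 h6))
      nlinarith
  have hin : ∀ F : Finset ι, RCLike.re (inner ℂ (∑ s ∈ F, inner ℂ (ψ s) u • ψ s) u) =
      ∑ s ∈ F, ‖inner ℂ (ψ s) u‖ ^ 2 := by
    intro F
    rw [sum_inner, map_sum]
    refine Finset.sum_congr rfl fun s _ => ?_
    rw [inner_smul_left, RCLike.conj_mul]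
    norm_cast
  -- Expand the square: the cross term is `-2 ∑ |c_s|²` and `‖P‖²` is at most `∑ |c_s|²`.
  have hdist : ∀ F : Finset ι, ‖∑ s ∈ F, inner ℂ (ψ s) u • ψ s - u‖ ^ 2 ≤
      ‖u‖ ^ 2 - ∑ s ∈ F, ‖inner ℂ (ψ s) u‖ ^ 2 := by
    intro F
    rw [norm_sub_sq (𝕜 := ℂ), hin]
    linarith [hle F]
  rw [HasSum, tendsto_iff_norm_sub_tendsto_zero]
  have hlim : Filter.Tendsto (fun F : Finset ι =>
      Real.sqrt (‖u‖ ^ 2 - ∑ s ∈ F, ‖inner ℂ (ψ s) u‖ ^ 2)) Filter.atTop (nhds 0) := by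
    have h8 := (Real.continuous_sqrt.tendsto _).comp (hu.const_sub (‖u‖ ^ 2))
    rw [sub_self, Real.sqrt_zero] at h8
    exact h8
  exact squeeze_zero (fun _ => norm_nonneg _)
    (fun F => Real.le_sqrt_of_sq_le (hdist F)) hlim

/-! ### Summation over scales, orientations and axes -/

section frame

variable (h : ℝ → ℂ) (L : ℤ → ℕ) (κ : ℤ → ℕ → ℤ → ℂ) (M : ℤ → ℕ)
  (R : (j : ℤ) → Fin (M j) → Rot3)

lemma tsum_pairing
    (h_calderon : ∀ ξ : E3, ξ ≠ 0 → HasSum (fun j : ℤ => ‖h ((2 : ℝ) ^ (-j) * ‖ξ‖)‖ ^ 2) 1)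
    (h_window : ∀ (j : ℤ) (v : E3), ‖v‖ = 1 →
      ∑ t, ‖angularWindow (L j) (κ j) (rotate (R j t)⁻¹ v)‖ ^ 2 = 1)
    (U : E3 → C3) {η : E3} (hη : η ≠ 0) :
    ∑' a, ∑' j, ∑' t, ENNReal.ofReal (‖pairing h L κ M R U a j t η‖ ^ 2) =
      ENNReal.ofReal (‖U η‖ ^ 2 - ‖∑ i, (((‖η‖⁻¹ • η) i : ℝ) : ℂ) * U η i‖ ^ 2) := by
  -- The Calderón condition at `2πη`, again because of the `2π` in the kernel of `𝓕`.
  have hA : HasSum (fun j : ℤ => ‖h (freqScale j * ‖η‖)‖ ^ 2) 1 := by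
    have h2 := h_calderon ((2 * Real.pi) • η) (smul_ne_zero (by positivity) hη)
    rw [norm_smul, Real.norm_of_nonneg (by positivity)] at h2
    convert! h2 using 5
    rw [freqScale]
    ring
  have hn := norm_normalize hη
  rw [← sum_norm_sq_inner_hedgehog hn, ENNReal.ofReal_sum_of_nonneg fun _ _ => by positivity,
    tsum_fintype]
  refine Finset.sum_congr rfl fun a _ => ?_
  set D := ‖inner ℂ (hedgehog a (‖η‖⁻¹ • η)) (U η)‖ ^ 2 with hD
  have ht : ∀ j, ∑' t, ENNReal.ofReal (‖pairing h L κ M R U a j t η‖ ^ 2) =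
      ENNReal.ofReal (‖h (freqScale j * ‖η‖)‖ ^ 2 * D) := by
    intro j
    rw [tsum_fintype, ← ENNReal.ofReal_sum_of_nonneg fun _ _ => by positivity]
    congr 1
    simp only [pairing, norm_sq_inner_waveletHat _ _ _ _ _ (freqScale_pos j)]
    rw [← Finset.sum_mul, ← Finset.mul_sum, h_window j _ hn, mul_one]
  simp only [ht]
  have hs := hA.mul_right D
  rw [one_mul] at hs
  rw [← ENNReal.ofReal_tsum_of_nonneg (fun _ => by positivity) hs.summable, hs.tsum_eq]

/-- Working with extended nonnegative reals makes every interchange of sums and integrals a case of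
Tonelli. The sum over `k` is brought innermost so that Parseval applies first. -/
lemma tsum_frame (h_meas : Measurable h) (h_band : ∀ r : ℝ, Real.pi < r → h r = 0)
    (h_calderon : ∀ ξ : E3, ξ ≠ 0 → HasSum (fun j : ℤ => ‖h ((2 : ℝ) ^ (-j) * ‖ξ‖)‖ ^ 2) 1)
    (h_window : ∀ (j : ℤ) (v : E3), ‖v‖ = 1 →
      ∑ t, ‖angularWindow (L j) (κ j) (rotate (R j t)⁻¹ v)‖ ^ 2 = 1)
    {U : E3 → C3} (hU : Measurable U) (hU2 : MemLp U 2 volume) :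
    ∑' s : FrameIndex M,
        ENNReal.ofReal (‖∫ η, inner ℂ (frameHat h L κ M R s η) (U η)‖ ^ 2) =
      ∫⁻ η, ENNReal.ofReal (‖U η‖ ^ 2 - ‖∑ i, (((‖η‖⁻¹ • η) i : ℝ) : ℂ) * U η i‖ ^ 2) := by
  have h1 : ∀ r : ℝ, 0 < r → ‖h r‖ ≤ 1 := fun r => norm_le_one_of_calderon h_calderon
  have hm : ∀ a j t, Measurable fun η =>
      ENNReal.ofReal (‖pairing h L κ M R U a j t η‖ ^ 2) := fun a j t =>
    ((measurable_pairing h L κ M R h_meas hU a j t).norm.pow_const 2).ennreal_ofReal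
  have hk : ∀ a j t, ∑' k : Fin 3 → ℤ,
      ENNReal.ofReal (‖∫ η, inner ℂ (frameHat h L κ M R (a, ⟨j, k, t⟩) η) (U η)‖ ^ 2) =
        ∫⁻ η, ENNReal.ofReal (‖pairing h L κ M R U a j t η‖ ^ 2) := by
    intro a j t
    have hs := hasSum_translates h L κ M R h_meas h_band h1 hU hU2 a j t
    rw [← ENNReal.ofReal_tsum_of_nonneg (fun _ => by positivity) hs.summable, hs.tsum_eq,
      ofReal_integral_eq_lintegral_ofReal]
    · exact (memLp_two_iff_integrable_sq_norm
        (measurable_pairing h L κ M R h_meas hU a j t).aestronglyMeasurable).1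
        (memLp_pairing h L κ M R h_meas h1 hU hU2 a j t)
    · exact Filter.Eventually.of_forall fun _ => by positivity
  have hsplit : ∑' s : FrameIndex M,
      ENNReal.ofReal (‖∫ η, inner ℂ (frameHat h L κ M R s η) (U η)‖ ^ 2) =
        ∑' a, ∑' j, ∑' t, ∫⁻ η, ENNReal.ofReal (‖pairing h L κ M R U a j t η‖ ^ 2) := by
    rw [ENNReal.tsum_prod']
    refine tsum_congr fun a => ?_
    rw [ENNReal.tsum_sigma']
    refine tsum_congr fun j => ?_
    rw [ENNReal.tsum_prod', ENNReal.tsum_comm]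
    exact tsum_congr fun t => hk a j t
  have hmt : ∀ a j, Measurable fun η =>
      ∑' t, ENNReal.ofReal (‖pairing h L κ M R U a j t η‖ ^ 2) := fun a j =>
    Measurable.tsum (hm a j)
  have hmj : ∀ a, Measurable fun η =>
      ∑' j, ∑' t, ENNReal.ofReal (‖pairing h L κ M R U a j t η‖ ^ 2) := fun a =>
    Measurable.tsum (hmt a)
  rw [hsplit]
  simp only [← lintegral_tsum fun t => (hm _ _ t).aemeasurable]
  simp only [← lintegral_tsum fun j => (hmt _ j).aemeasurable]
  rw [← lintegral_tsum fun a => (hmj a).aemeasurable]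
  refine lintegral_congr_ae ?_
  filter_upwards [compl_mem_ae_iff.2 (measure_singleton (0 : E3))] with η hη
  exact tsum_pairing h L κ M R h_calderon h_window U hη

lemma memLp_frameFun (h_meas : Measurable h) (h_band : ∀ r : ℝ, Real.pi < r → h r = 0)
    (h1 : ∀ r : ℝ, 0 < r → ‖h r‖ ≤ 1) (s : FrameIndex M) :
    MemLp (frameFun h L κ M R s) 2 (volume : Measure E3) := by
  rw [frameFun_eq_fourierInv]
  exact memLp_fourierInv
    (memLp_one_iff_integrable.1 (memLp_frameHat h L κ M R h_meas h_band h1 s 1))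
    (memLp_frameHat h L κ M R h_meas h_band h1 s 2)

lemma inner_frameFun (h_meas : Measurable h) (h_band : ∀ r : ℝ, Real.pi < r → h r = 0)
    (h1 : ∀ r : ℝ, 0 < r → ‖h r‖ ≤ 1) (s : FrameIndex M)
    (hψ : MemLp (frameFun h L κ M R s) 2 (volume : Measure E3))
    (u : Lp C3 2 (volume : Measure E3)) :
    inner ℂ (hψ.toLp _) u =
      ∫ η, inner ℂ (frameHat h L κ M R s η) ((𝓕 u : Lp C3 2 (volume : Measure E3)) η) := by
  have hi := memLp_one_iff_integrable.1 (memLp_frameHat h L κ M R h_meas h_band h1 s 1)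
  have h2 := memLp_frameHat h L κ M R h_meas h_band h1 s 2
  have e : hψ.toLp _ = (memLp_fourierInv hi h2).toLp _ :=
    MemLp.toLp_congr _ _ (by rw [frameFun_eq_fourierInv])
  rw [e, inner_toLp_fourierInv hi h2, L2.inner_def]
  refine integral_congr_ae ?_
  filter_upwards [h2.coeFn_toLp] with η hη
  rw [hη]

end frame

/-! ### Bessel for all fields, Parseval for divergence-free fields -/

lemma integral_norm_sq_Lp (u : Lp C3 2 (volume : Measure E3)) :
    ∫ x, ‖u x‖ ^ 2 = ‖u‖ ^ 2 := by
  have h1 : inner ℂ u u = ((∫ x, ‖u x‖ ^ 2 : ℝ) : ℂ) := by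
    rw [L2.inner_def, ← integral_complex_ofReal]
    congr 1
    ext x
    rw [inner_self_eq_norm_sq_to_K]
    norm_cast
  rw [inner_self_eq_norm_sq_to_K] at h1
  exact Complex.ofReal_injective (by rw [← h1]; push_cast; rfl)

lemma lintegral_norm_sq_Lp (u : Lp C3 2 (volume : Measure E3)) :
    ∫⁻ x, ENNReal.ofReal (‖u x‖ ^ 2) = ENNReal.ofReal (‖u‖ ^ 2) := by
  rw [← integral_norm_sq_Lp, ofReal_integral_eq_lintegral_ofReal]
  · exact (memLp_two_iff_integrable_sq_norm (Lp.memLp u).1).1 (Lp.memLp u)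
  · exact Filter.Eventually.of_forall fun _ => by positivity

/-- The square sum of the frame coefficients in terms of the Fourier transform. -/
lemma tsum_inner_frameFun {h : ℝ → ℂ} (h_meas : Measurable h)
    (h_band : ∀ r : ℝ, Real.pi < r → h r = 0)
    (h_calderon : ∀ ξ : E3, ξ ≠ 0 → HasSum (fun j : ℤ => ‖h ((2 : ℝ) ^ (-j) * ‖ξ‖)‖ ^ 2) 1)
    {L : ℤ → ℕ} {κ : ℤ → ℕ → ℤ → ℂ} {M : ℤ → ℕ} {R : (j : ℤ) → Fin (M j) → Rot3}
    (h_window : ∀ (j : ℤ) (v : E3), ‖v‖ = 1 →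
      ∑ t, ‖angularWindow (L j) (κ j) (rotate (R j t)⁻¹ v)‖ ^ 2 = 1)
    (hψ : ∀ s : FrameIndex M, MemLp (frameFun h L κ M R s) 2 (volume : Measure E3))
    (u : Lp C3 2 (volume : Measure E3)) :
    ∑' s, ENNReal.ofReal (‖inner ℂ ((hψ s).toLp _) u‖ ^ 2) =
      ∫⁻ η, ENNReal.ofReal (‖(𝓕 u : Lp C3 2 (volume : Measure E3)) η‖ ^ 2 -
        ‖∑ i, (((‖η‖⁻¹ • η) i : ℝ) : ℂ) *
          (𝓕 u : Lp C3 2 (volume : Measure E3)) η i‖ ^ 2) := by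
  rw [← tsum_frame h L κ M R h_meas h_band h_calderon h_window
    (Lp.stronglyMeasurable _).measurable (Lp.memLp _)]
  exact tsum_congr fun s => by
    rw [inner_frameFun h L κ M R h_meas h_band (fun r => norm_le_one_of_calderon h_calderon) s]

lemma lintegral_norm_sq_fourier (u : Lp C3 2 (volume : Measure E3)) :
    ∫⁻ η, ENNReal.ofReal (‖(𝓕 u : Lp C3 2 (volume : Measure E3)) η‖ ^ 2) =
      ENNReal.ofReal (‖u‖ ^ 2) := by
  rw [lintegral_norm_sq_Lp, Lp.norm_fourier_eq]

lemma lintegral_solenoidal_part_le (u : Lp C3 2 (volume : Measure E3)) :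
    ∫⁻ η, ENNReal.ofReal (‖(𝓕 u : Lp C3 2 (volume : Measure E3)) η‖ ^ 2 -
      ‖∑ i, (((‖η‖⁻¹ • η) i : ℝ) : ℂ) *
        (𝓕 u : Lp C3 2 (volume : Measure E3)) η i‖ ^ 2) ≤ ENNReal.ofReal (‖u‖ ^ 2) := by
  rw [← lintegral_norm_sq_fourier]
  exact lintegral_mono fun η => ENNReal.ofReal_le_ofReal (sub_le_self _ (by positivity))

/-- The subtracted longitudinal component vanishes almost everywhere. -/
lemma IsDivFree.lintegral_solenoidal_part {u : Lp C3 2 (volume : Measure E3)} (hu : IsDivFree u) :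
    ∫⁻ η, ENNReal.ofReal (‖(𝓕 u : Lp C3 2 (volume : Measure E3)) η‖ ^ 2 -
      ‖∑ i, (((‖η‖⁻¹ • η) i : ℝ) : ℂ) *
        (𝓕 u : Lp C3 2 (volume : Measure E3)) η i‖ ^ 2) = ENNReal.ofReal (‖u‖ ^ 2) := by
  rw [← lintegral_norm_sq_fourier]
  refine lintegral_congr_ae ?_
  filter_upwards [hu.sum_mul_fourier_eq_zero] with η hη
  have h0 : ∑ i, (((‖η‖⁻¹ • η) i : ℝ) : ℂ) *
      (𝓕 u : Lp C3 2 (volume : Measure E3)) η i = 0 := by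
    have h2 := congrArg (fun z => ((‖η‖⁻¹ : ℝ) : ℂ) * z) hη
    simp only [mul_zero, Finset.mul_sum] at h2
    rw [← h2]
    refine Finset.sum_congr rfl fun i _ => ?_
    simp only [PiLp.smul_apply, smul_eq_mul, Complex.ofReal_mul, mul_assoc]
  rw [h0]
  simp

end DivFreeWavelet

theorem mainTheorem2
    (h : ℝ → ℂ) (h_meas : Measurable h)
    (h_band : ∀ r : ℝ, Real.pi < r → h r = 0)
    (h_calderon : ∀ ξ : E3, ξ ≠ 0 → HasSum (fun j : ℤ => ‖h ((2 : ℝ) ^ (-j) * ‖ξ‖)‖ ^ 2) 1)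
    (L : ℤ → ℕ) (κ : ℤ → ℕ → ℤ → ℂ)
    (M : ℤ → ℕ) (R : (j : ℤ) → Fin (M j) → Rot3)
    (h_angular : ∀ (j : ℤ) (l : ℕ) (m : ℤ), m ∈ Finset.Icc (-(l : ℤ)) (l : ℤ) →
      ∑ t : Fin (M j),
        dotProduct (coeffVec (L j) (conjCoeff (rotCoeff (R j t) (κ j))))
          (Matrix.mulVec (shProdMatrix (L j) l m) (coeffVec (L j) (rotCoeff (R j t) (κ j)))) =
        if l = 0 ∧ m = 0 then ((Real.sqrt (4 * Real.pi) : ℝ) : ℂ) else 0) :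
    ∃ hψ : ∀ s : FrameIndex M, MemLp (frameFun h L κ M R s) 2 (volume : Measure E3),
      (∀ s : FrameIndex M, IsDivFree (frameFun h L κ M R s)) ∧
      ∀ u : Lp C3 2 (volume : Measure E3), IsDivFree u →
        HasSum (fun s : FrameIndex M => inner ℂ ((hψ s).toLp _) u • (hψ s).toLp _) u ∧
        HasSum (fun s : FrameIndex M => ‖inner ℂ ((hψ s).toLp _) u‖ ^ 2) (‖u‖ ^ 2) := by
  have h1 : ∀ r : ℝ, 0 < r → ‖h r‖ ≤ 1 := fun r => norm_le_one_of_calderon h_calderon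
  have hψ := memLp_frameFun h L κ M R h_meas h_band h1
  have h_window : ∀ (j : ℤ) (v : E3), ‖v‖ = 1 →
      ∑ t, ‖angularWindow (L j) (κ j) (rotate (R j t)⁻¹ v)‖ ^ 2 = 1 := fun j =>
    sum_norm_sq_angularWindow (L j) (κ j) (R j) (h_angular j)
  have htsum := tsum_inner_frameFun h_meas h_band h_calderon h_window hψ
  refine ⟨hψ, fun s => isDivFree_frameFun h L κ M R s
    (memLp_one_iff_integrable.1 (memLp_frameHat h L κ M R h_meas h_band h1 s 1)), fun u hu => ?_⟩
  have heq := (htsum u).trans hu.lintegral_solenoidal_part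
  have hsum : HasSum (fun s : FrameIndex M => ‖inner ℂ ((hψ s).toLp _) u‖ ^ 2) (‖u‖ ^ 2) := by
    have h2 := ENNReal.hasSum_toReal (heq.trans_ne ENNReal.ofReal_ne_top)
    rw [← ENNReal.tsum_toReal_eq fun s => ENNReal.ofReal_ne_top, heq,
      ENNReal.toReal_ofReal (by positivity)] at h2
    refine h2.congr_fun fun s => ?_
    rw [ENNReal.toReal_ofReal (by positivity)]
  refine ⟨hasSum_inner_smul _ (fun v F => ?_) u hsum, hsum⟩
  -- Bessel for an arbitrary `v`: a finite sum is at most the total, in which the longitudinal part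
  -- is only subtracted.
  have h2 := (ENNReal.sum_le_tsum F).trans ((htsum v).le.trans (lintegral_solenoidal_part_le v))
  rw [← ENNReal.ofReal_sum_of_nonneg fun _ _ => by positivity] at h2
  exact (ENNReal.ofReal_le_ofReal_iff (by positivity)).1 h2
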